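/- Consider a single-good market. A consumer has a private type $\theta\in[0,1]$ drawn from a distribution $F$ on $[0,1]$ that has a continuous density $f$, positive on $(0,1]$; $F$ is \emph{strongly regular}, i.e. $f$ is nondecreasing and log-concave. Given a tax policy $\sigma:[0,1]\to\mathbb R$ (a subsidy to the consumer as a function of the quantity), a direct mechanism $(q,t)$ with $q:[0,1]\to[0,1]$ and $t:[0,1]\to[0,\infty)$ gives a truthful type $\theta$ the \emph{information rent} $I(\theta)=\theta q(\theta)-t(\theta)+\sigma(q(\theta))$. It is \emph{incentive compatible} if $I(\theta)\ge\theta q(\theta')-t(\theta')+\sigma(q(\theta'))$ for all $\theta,\theta'\in[0,1]$, and \emph{individually rational} if $I(\theta)\ge\sigma(0)$ for all $\theta$. It is \emph{optimal given $\sigma$} if it maximizes the revenue $\mathbb E_F[t(\theta)]$ among all incentive compatible and individually rational direct mechanisms of finite expected revenue. An information rent is \emph{feasible} if, for some $\sigma$, it is induced by a mechanism $(q,t)$ that is optimal given $\sigma$ and satisfies $\mathbb E_F[\sigma(q(\theta))]\le 0$. A feasible $I$ is \emph{$F$-unimprovable} if there is no feasible $I'$ such that the distribution of $I'(\theta)$,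 $\theta\sim F$, second order stochastically dominates that of $I(\theta)$ and $\mathbb E_F[I']\ge\mathbb E_F[I]$, with at least one of these two comparisons strict. A \emph{monopoly mechanism} is a mechanism $(\bar q,\bar t)$ that is optimal given $\sigma=0$. Then there is a monopoly mechanism whose allocation is a threshold allocation $\bar q=\mathbf 1_{[k,1]}$, and for every monopoly mechanism $(\bar q,\bar t)$: (i) if $I$ is $F$-unimprovable and is the information rent of an incentive compatible direct mechanism $(q,t)$ under a policy $\sigma$, then $\bar q(\theta)=0$ implies $q(\theta)=0$, for every $\theta\in[0,1]$; (ii) the information rent of $(\bar q,\bar t)$ under $\sigma=0$ is feasible but not $F$-unimprovable. Moreover, if $(q,t)$ is optimal given an excise policy $\sigma(Q)=C-\tau Q$ with $C,\tau\in\mathbb R$, and its information rent is $F$-unimprovable, then $\tau>0$: only excise taxes, never subsidies ($\tau<0$) or a zero rate, lie on the frontier. -/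

import Mathlib

open MeasureTheory Set
open scoped ENNReal

noncomputable section

namespace SupraPricing

/-- The type distribution `F` is a probability distribution on `[0, 1]` with a continuous density
`f` that is positive on `(0, 1]` (a zero of the density is tolerated at the single point `0`, as
for the power distributions). -/
structure IsTypeDistribution (F : Measure ℝ) (f : ℝ → ℝ) : Prop where
  isProbabilityMeasure : IsProbabilityMeasure F
  eq_withDensity :
    F = (volume.restrict (Icc (0 : ℝ) 1)).withDensity (fun θ => ENNReal.ofReal (f θ))
  continuousOn : ContinuousOn f (Icc 0 1)
  pos : ∀ θ ∈ Ioc (0 : ℝ) 1, 0 < f θ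

/-- Strong regularity: the density is nondecreasing and log-concave. Log-concavity is required on
`(0, 1]`, where the density is positive; by continuity it then extends to `[0, 1]` with
`log 0 = -∞`. -/
structure IsStronglyRegular (f : ℝ → ℝ) : Prop where
  monotoneOn : MonotoneOn f (Icc 0 1)
  logConcaveOn : ConcaveOn ℝ (Ioc 0 1) (fun θ => Real.log (f θ))

/-- The information rent `θ q(θ) - t(θ) + σ(q(θ))` of a truthful type `θ`. -/
def infoRent (σ q t : ℝ → ℝ) (θ : ℝ) : ℝ := θ * q θ - t θ + σ (q θ)

/-- `(q, t)` is an incentive compatible direct mechanism under the tax policy `σ`: quantities lie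
in `[0, 1]`, transfers to the firm are nonnegative, and truthful reporting is optimal for every
type in `[0, 1]`. -/
structure IsIncentiveCompatible (σ q t : ℝ → ℝ) : Prop where
  quantity_mem : ∀ θ ∈ Icc (0 : ℝ) 1, q θ ∈ Icc (0 : ℝ) 1
  transfer_nonneg : ∀ θ ∈ Icc (0 : ℝ) 1, 0 ≤ t θ
  truthful : ∀ θ ∈ Icc (0 : ℝ) 1, ∀ θ' ∈ Icc (0 : ℝ) 1,
    θ * q θ' - t θ' + σ (q θ') ≤ infoRent σ q t θ

/-- The direct mechanisms among which the firm chooses: incentive compatible, individually rational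
(a consumer who does not participate has quantity `0`, pays `0`, and so obtains `σ 0`), with a
well-defined expected revenue. -/
structure IsImplementable (F : Measure ℝ) (σ q t : ℝ → ℝ) : Prop where
  incentiveCompatible : IsIncentiveCompatible σ q t
  individuallyRational : ∀ θ ∈ Icc (0 : ℝ) 1, σ 0 ≤ infoRent σ q t θ
  integrable : Integrable t F

/-- `(q, t)` is optimal for the firm given `σ`: it maximizes expected revenue. -/
structure IsOptimal (F : Measure ℝ) (σ q t : ℝ → ℝ) : Prop where
  implementable : IsImplementable F σ q t
  revenue_le : ∀ q' t' : ℝ → ℝ, IsImplementable F σ q' t' → ∫ θ, t' θ ∂F ≤ ∫ θ, t θ ∂F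

/-- The policy has nonpositive expected net cost: `E_F[σ(q(θ))] ≤ 0`. -/
def IsBudgetBalanced (F : Measure ℝ) (σ q : ℝ → ℝ) : Prop :=
  Integrable (fun θ => σ (q θ)) F ∧ ∫ θ, σ (q θ) ∂F ≤ 0

/-- `I` is the information rent, as a function on `[0, 1]`, of `(q, t)` under `σ`. -/
def IsInducedBy (I σ q t : ℝ → ℝ) : Prop :=
  ∀ θ ∈ Icc (0 : ℝ) 1, I θ = infoRent σ q t θ

/-- An information rent is feasible if it is induced by a budget balanced mechanism that is optimal
for the firm given some tax policy. -/
def IsFeasible (F : Measure ℝ) (I : ℝ → ℝ) : Prop :=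
  ∃ σ q t : ℝ → ℝ, IsOptimal F σ q t ∧ IsBudgetBalanced F σ q ∧ IsInducedBy I σ q t

/-- The distribution function `x ↦ P_F(I(θ) ≤ x)` of information rents. -/
def rentCDF (F : Measure ℝ) (I : ℝ → ℝ) (x : ℝ) : ℝ≥0∞ := F {θ | I θ ≤ x}

/-- `I'` is more fair than `I`: the distribution of `I'` second order stochastically dominates
that of `I`. -/
def IsMoreFair (F : Measure ℝ) (I' I : ℝ → ℝ) : Prop :=
  ∀ z : ℝ, ∫⁻ x in Iic z, rentCDF F I' x ≤ ∫⁻ x in Iic z, rentCDF F I x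

/-- `I'` is more efficient than `I`: it has at least as large an expectation. -/
def IsMoreEfficient (F : Measure ℝ) (I' I : ℝ → ℝ) : Prop :=
  ∫ θ, I θ ∂F ≤ ∫ θ, I' θ ∂F

/-- `I` is `F`-unimprovable: it is feasible, and no feasible `I'` is more fair and more efficient
than `I` with at least one of the two comparisons strict. -/
def IsUnimprovable (F : Measure ℝ) (I : ℝ → ℝ) : Prop :=
  IsFeasible F I ∧
    ¬ ∃ I' : ℝ → ℝ, IsFeasible F I' ∧ IsMoreFair F I' I ∧ IsMoreEfficient F I' I ∧
      (¬ IsMoreFair F I I' ∨ ¬ IsMoreEfficient F I I')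

/-- The threshold allocation `1_{[k, 1]}`. -/
def threshold (k : ℝ) : ℝ → ℝ := (Icc k 1).indicator (fun _ => 1)

/-- No taxes and no subsidies. -/
def noTax : ℝ → ℝ := fun _ => 0

/-- The excise policy `Q ↦ C - τ Q`: a tax on each unit if `τ > 0`, a subsidy if `τ < 0`. -/
def excise (C τ : ℝ) : ℝ → ℝ := fun Q => C - τ * Q

end SupraPricing

end

/-! An incentive compatible allocation is nondecreasing, so it is given by thresholds: unit `x` goes
to the types above `h x`. Up to the rent of type 0, the net payment is the integral of `h` up to the
quantity, and the remaining rent of `θ` is the integral over units of the positive part of `θ - h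
x`. If the policy has marginal tax `φ x`, Tonelli turns expected revenue into the integral of `G (h
x) * (h x - φ x)` plus a constant: one monopoly problem per unit, with demand `G` and cost `φ x`.
Since `f` is nondecreasing, `G` is concave, and a marginal tax equal to the virtual value `g x - G
(g x) / f (g x)` makes the threshold `g x` optimal (`IsLayered.isOptimal`). With a rate `τ ≤ 0` no
threshold exceeds the `k` with `k f(k) = G(k)`, so every type above `k` is fully served
(`eq_one_of_isOptimal_excise`).

The core is `not_isUnimprovable`. If quantities stay above some `m > 0` right of `k`, raise all
thresholds to at least some `k'` slightly above `k` and rebate the tax proceeds. Mean rent is gains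
from trade minus revenue plus the cost of the policy. A unit with `h x < k'` loses at most `k' (G(h)
- G(k'))` of gains from trade, while the bound on revenue falls by `(G(h)² - G(k')²) / f(k')`, which
is more because `k' f(k') < 2 G(k')`. The mean rises, and the change of rent is nonincreasing in the
type, so the new rents also dominate in second order.

The original policy is arbitrary, so its revenue has to be bounded below by optimality alone
(`IsOptimal.integral_le`): the firm could offer the same quantities to an audience shrunk by a
factor `l < 1` at higher prices; that this does not pay gives the bound as `l → 1`. -/

noncomputable section

namespace SupraPricing

/-! ### Thresholds of an allocation and integration over units. -/

/-- `h` is a generalized inverse of the allocation `q`: the `x`-th unit is sold to the types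
above `h x`. -/
structure IsLayered (q h : ℝ → ℝ) : Prop where
  mono : Monotone h
  mem : ∀ x, h x ∈ Icc (0 : ℝ) 1
  quantity_mem : ∀ θ ∈ Icc (0 : ℝ) 1, q θ ∈ Icc (0 : ℝ) 1
  le_of_lt : ∀ θ ∈ Icc (0 : ℝ) 1, ∀ x ∈ Icc (0 : ℝ) 1, x < q θ → h x ≤ θ
  le_of_gt : ∀ θ ∈ Icc (0 : ℝ) 1, ∀ x ∈ Icc (0 : ℝ) 1, q θ < x → θ ≤ h x

/-- The threshold is the supremum of the types with `q θ < x`. Inserting 0 keeps the set nonempty,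
so `h` is monotone with values in `[0, 1]` on all of `ℝ`. -/
theorem exists_isLayered {q : ℝ → ℝ} (hq : MonotoneOn q (Icc 0 1))
    (hmem : ∀ θ ∈ Icc (0 : ℝ) 1, q θ ∈ Icc (0 : ℝ) 1) : ∃ h, IsLayered q h := by
  let S : ℝ → Set ℝ := fun x => insert 0 {θ | θ ∈ Icc (0 : ℝ) 1 ∧ q θ < x}
  have hS : ∀ x, ∀ s ∈ S x, s ∈ Icc (0 : ℝ) 1 := by
    rintro x s (rfl | hs)
    · simp
    · exact hs.1
  have hb : ∀ x, BddAbove (S x) := fun x => ⟨1, fun s hs => (hS x s hs).2⟩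
  have hne : ∀ x, (S x).Nonempty := fun x => ⟨0, mem_insert _ _⟩
  refine ⟨fun x => sSup (S x), ⟨?_, ?_, hmem, ?_, ?_⟩⟩
  · intro x y hxy
    refine csSup_le_csSup (hb y) (hne x) ?_
    rintro s (rfl | hs)
    · exact mem_insert _ _
    · exact Or.inr ⟨hs.1, hs.2.trans_le hxy⟩
  · exact fun x => ⟨le_csSup (hb x) (mem_insert _ _), csSup_le (hne x) fun s hs => (hS x s hs).2⟩
  · intro θ hθ x _ hx
    refine csSup_le (hne x) ?_
    rintro s (rfl | hs)
    · exact hθ.1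
    · by_contra! hlt
      exact absurd (hq hθ hs.1 hlt.le) (by linarith [hs.2])
  · intro θ hθ x _ hx
    exact le_csSup (hb x) (Or.inr ⟨hθ, hx⟩)

/-- Trades the type-dependent upper limit for a fixed domain, as Tonelli requires. The unit `x = q
θ`, about which `IsLayered` says nothing, is a null set. -/
theorem IsLayered.integral_eq {q h : ℝ → ℝ} (hl : IsLayered q h) {θ : ℝ} (hθ : θ ∈ Icc (0 : ℝ) 1)
    {w v : ℝ → ℝ} (hlt : ∀ᵐ x : ℝ, x ∈ Icc (0 : ℝ) 1 → x < q θ → w x = v x)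
    (hgt : ∀ᵐ x : ℝ, x ∈ Icc (0 : ℝ) 1 → q θ < x → v x = 0) :
    ∫ x in (0 : ℝ)..q θ, w x = ∫ x in Ioc (0 : ℝ) 1, v x := by
  have hq := hl.quantity_mem θ hθ
  rw [intervalIntegral.integral_of_le hq.1]
  have h1 : Ioc 0 (q θ) = Ioc 0 1 ∩ Iic (q θ) := by
    ext x; simp only [mem_Ioc, mem_inter_iff, mem_Iic]
    exact ⟨fun hx => ⟨⟨hx.1, hx.2.trans hq.2⟩, hx.2⟩, fun hx => ⟨hx.1.1, hx.2⟩⟩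
  rw [h1, ← setIntegral_indicator measurableSet_Iic]
  refine setIntegral_congr_ae measurableSet_Ioc ?_
  have hae : ∀ᵐ x : ℝ, x ≠ q θ := by simp [ae_iff]
  filter_upwards [hae, hlt, hgt] with x hx hlt hgt hx1
  have hx01 : x ∈ Icc (0 : ℝ) 1 := ⟨hx1.1.le, hx1.2⟩
  rcases lt_or_gt_of_ne hx with hlt' | hgt'
  · rw [indicator_of_mem (by exact hlt'.le), hlt hx01 hlt']
  · rw [indicator_of_notMem (by simpa using hgt'), hgt hx01 hgt']

theorem IsLayered.integral_sub_eq {q h : ℝ → ℝ} (hl : IsLayered q h) {θ : ℝ}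
    (hθ : θ ∈ Icc (0 : ℝ) 1) :
    ∫ x in (0 : ℝ)..q θ, (θ - h x) = ∫ x in Ioc (0 : ℝ) 1, max (θ - h x) 0 := by
  refine hl.integral_eq hθ (ae_of_all _ fun x hx hlt => ?_) (ae_of_all _ fun x hx hgt => ?_)
  · rw [max_eq_left (by linarith [hl.le_of_lt θ hθ x hx hlt])]
  · rw [max_eq_right (by linarith [hl.le_of_gt θ hθ x hx hgt])]

theorem IsLayered.intervalIntegrable {q h : ℝ → ℝ} (hl : IsLayered q h) (a b : ℝ) :
    IntervalIntegrable h volume a b := hl.mono.intervalIntegrable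

/-- Tonelli's theorem for the region below the graph of a layered allocation. -/
theorem IsLayered.integrable_and_integral {F : Measure ℝ} [IsProbabilityMeasure F] [NullSingletonClass F]
    (hF : ∀ᵐ θ ∂F, θ ∈ Icc (0 : ℝ) 1) {q h : ℝ → ℝ} (hl : IsLayered q h) {w : ℝ → ℝ} {B : ℝ}
    (hw : Measurable w) (hB : ∀ x ∈ Ioc (0 : ℝ) 1, |w x| ≤ B) :
    Integrable (fun θ => ∫ x in (0 : ℝ)..q θ, w x) F ∧
      ∫ θ, (∫ x in (0 : ℝ)..q θ, w x) ∂F = ∫ x in Ioc (0 : ℝ) 1, F.real (Ici (h x)) * w x := by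
  have hS : MeasurableSet {p : ℝ × ℝ | h p.2 ≤ p.1} :=
    measurableSet_le (hl.mono.measurable.comp measurable_snd) measurable_fst
  -- `IsLayered` does not decide whether the type equal to the threshold buys; this tie has measure
  -- zero for each `x` as `F` has no atoms.
  have hne : ∀ᵐ θ ∂F, ∀ᵐ x : ℝ, θ ≠ h x := by
    rw [Measure.ae_ae_comm]
    · exact ae_of_all _ fun x => by simp [ae_iff]
    · exact (measurableSet_eq_fun measurable_fst
        (hl.mono.measurable.comp measurable_snd)).compl
  have hae : (fun θ => ∫ x in (0 : ℝ)..q θ, w x) =ᵐ[F]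
      fun θ => ∫ x in Ioc (0 : ℝ) 1, {p : ℝ × ℝ | h p.2 ≤ p.1}.indicator (fun p => w p.2) (θ, x) := by
    filter_upwards [hF, hne] with θ hθ hθ'
    refine hl.integral_eq hθ (ae_of_all _ fun x hx hlt => ?_) ?_
    · rw [indicator_of_mem (by exact hl.le_of_lt θ hθ x hx hlt)]
    · filter_upwards [hθ'] with x hx hx1 hgt
      rw [indicator_of_notMem]
      exact not_le.mpr (lt_of_le_of_ne (hl.le_of_gt θ hθ x hx1 hgt) hx)
  have hint : Integrable ({p : ℝ × ℝ | h p.2 ≤ p.1}.indicator (fun p => w p.2))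
      (F.prod (volume.restrict (Ioc (0 : ℝ) 1))) := by
    refine Integrable.indicator ?_ hS
    have : Integrable w (volume.restrict (Ioc (0 : ℝ) 1)) := by
      refine Integrable.of_bound hw.aestronglyMeasurable B ?_
      exact (ae_restrict_iff' measurableSet_Ioc).2 (ae_of_all _ hB)
    exact this.comp_snd F
  refine ⟨hint.integral_prod_left.congr hae.symm, ?_⟩
  rw [integral_congr_ae hae, integral_integral_swap
    (f := fun θ x => {p : ℝ × ℝ | h p.2 ≤ p.1}.indicator (fun p => w p.2) (θ, x)) hint]
  refine integral_congr_ae (ae_of_all _ fun x => ?_)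
  have : (fun θ => {p : ℝ × ℝ | h p.2 ≤ p.1}.indicator (fun p => w p.2) (θ, x)) =
      (Ici (h x)).indicator fun _ => w x := by
    ext θ; simp [indicator]
  simp only [this]
  rw [integral_indicator measurableSet_Ici]
  simp

/-! ### Incentive compatibility as a nonlinear price schedule. -/

/-- A marginal value that changes sign from positive to negative at the quantity `Q` makes `Q`
the best quantity. -/
theorem integral_le_integral_of_sign {v : ℝ → ℝ} {Q Q' : ℝ} (hQ : Q ∈ Icc (0 : ℝ) 1)
    (hQ' : Q' ∈ Icc (0 : ℝ) 1) (hv : IntervalIntegrable v volume 0 1)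
    (hpos : ∀ x ∈ Icc (0 : ℝ) 1, x < Q → 0 ≤ v x) (hneg : ∀ x ∈ Icc (0 : ℝ) 1, Q < x → v x ≤ 0) :
    ∫ x in (0 : ℝ)..Q', v x ≤ ∫ x in (0 : ℝ)..Q, v x := by
  have hsub : ∀ a ∈ Icc (0 : ℝ) 1, ∀ b ∈ Icc (0 : ℝ) 1, IntervalIntegrable v volume a b := by
    intro a ha b hb
    refine hv.mono_set ?_
    rw [uIcc_of_le zero_le_one]
    exact uIcc_subset_Icc ha hb
  have h0 : (0 : ℝ) ∈ Icc (0 : ℝ) 1 := by simp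
  rw [← sub_nonneg, intervalIntegral.integral_interval_sub_left (hsub 0 h0 Q hQ) (hsub 0 h0 Q' hQ')]
  rcases le_total Q' Q with hle | hle
  · refine intervalIntegral.integral_nonneg_of_ae_restrict hle ?_
    rw [Filter.EventuallyLE, ae_restrict_iff' measurableSet_Icc]
    have hae : ∀ᵐ x : ℝ, x ≠ Q := by simp [ae_iff]
    filter_upwards [hae] with x hx hx1
    exact hpos x ⟨hQ'.1.trans hx1.1, hx1.2.trans hQ.2⟩ (lt_of_le_of_ne hx1.2 hx)
  · rw [intervalIntegral.integral_symm, ← intervalIntegral.integral_neg]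
    refine intervalIntegral.integral_nonneg_of_ae_restrict hle ?_
    rw [Filter.EventuallyLE, ae_restrict_iff' measurableSet_Icc]
    have hae : ∀ᵐ x : ℝ, x ≠ Q := by simp [ae_iff]
    filter_upwards [hae] with x hx hx1
    exact neg_nonneg.2 (hneg x ⟨hQ.1.trans hx1.1, hx1.2.trans hQ'.2⟩ (lt_of_le_of_ne' hx1.1 hx))

theorem IsLayered.integral_sub_le {q h : ℝ → ℝ} (hl : IsLayered q h) {θ Q : ℝ}
    (hθ : θ ∈ Icc (0 : ℝ) 1) (hQ : Q ∈ Icc (0 : ℝ) 1) :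
    ∫ x in (0 : ℝ)..Q, (θ - h x) ≤ ∫ x in (0 : ℝ)..q θ, (θ - h x) :=
  integral_le_integral_of_sign (hl.quantity_mem θ hθ) hQ
    (intervalIntegrable_const.sub (hl.intervalIntegrable 0 1))
    (fun x hx hlt => sub_nonneg.2 (hl.le_of_lt θ hθ x hx hlt))
    (fun x hx hgt => sub_nonpos.2 (hl.le_of_gt θ hθ x hx hgt))

theorem IsLayered.integral_sub {q h : ℝ → ℝ} (hl : IsLayered q h) (θ Q : ℝ) :
    ∫ x in (0 : ℝ)..Q, (θ - h x) = θ * Q - ∫ x in (0 : ℝ)..Q, h x := by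
  rw [intervalIntegral.integral_sub intervalIntegrable_const (hl.intervalIntegrable 0 Q)]
  simp [mul_comm]

/-- A nonlinear price schedule whose marginal price is a generalized inverse of the allocation
implements the allocation. -/
theorem IsLayered.isIncentiveCompatible {σ q t h : ℝ → ℝ} {a : ℝ} (hl : IsLayered q h)
    (ht : ∀ θ ∈ Icc (0 : ℝ) 1, 0 ≤ t θ)
    (heq : ∀ θ ∈ Icc (0 : ℝ) 1, t θ - σ (q θ) = (∫ x in (0 : ℝ)..q θ, h x) - a) :
    IsIncentiveCompatible σ q t ∧
      ∀ θ ∈ Icc (0 : ℝ) 1, infoRent σ q t θ = a + ∫ x in (0 : ℝ)..q θ, (θ - h x) := by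
  have key : ∀ θ, ∀ θ' ∈ Icc (0 : ℝ) 1, θ * q θ' - t θ' + σ (q θ') =
      a + ∫ x in (0 : ℝ)..q θ', (θ - h x) := by
    intro θ θ' hθ'
    rw [hl.integral_sub]
    linarith [heq θ' hθ']
  refine ⟨⟨hl.quantity_mem, ht, fun θ hθ θ' hθ' => ?_⟩, fun θ hθ => key θ θ hθ⟩
  rw [infoRent, key θ θ' hθ', key θ θ hθ]
  linarith [hl.integral_sub_le hθ (hl.quantity_mem θ' hθ')]

theorem IsLayered.integral_sub_nonneg {q h : ℝ → ℝ} (hl : IsLayered q h) {θ : ℝ}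
    (hθ : θ ∈ Icc (0 : ℝ) 1) : 0 ≤ ∫ x in (0 : ℝ)..q θ, (θ - h x) := by
  simpa using hl.integral_sub_le hθ (Q := 0) (by simp)

/-- Two functions with a common monotone subgradient differ by a constant. -/
theorem sub_eq_of_subgradient {A B q : ℝ → ℝ}
    (hq : ∀ θ ∈ Icc (0 : ℝ) 1, q θ ∈ Icc (0 : ℝ) 1)
    (hA : ∀ θ ∈ Icc (0 : ℝ) 1, ∀ θ' ∈ Icc (0 : ℝ) 1, (θ - θ') * q θ' ≤ A θ - A θ')
    (hB : ∀ θ ∈ Icc (0 : ℝ) 1, ∀ θ' ∈ Icc (0 : ℝ) 1, (θ - θ') * q θ' ≤ B θ - B θ')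
    {θ : ℝ} (hθ : θ ∈ Icc (0 : ℝ) 1) : A θ - A 0 = B θ - B 0 := by
  have hD : ∀ a ∈ Icc (0 : ℝ) 1, ∀ b ∈ Icc (0 : ℝ) 1,
      |(A b - B b) - (A a - B a)| ≤ (b - a) * (q b - q a) := by
    intro a ha b hb
    have h1 := hA a ha b hb
    have h2 := hA b hb a ha
    have h3 := hB a ha b hb
    have h4 := hB b hb a ha
    rw [abs_le]
    constructor <;> nlinarith
  -- Over `n` equal steps the bounds `hD` telescope to `θ / n * (q θ - q 0)`, so no
  -- differentiability is needed.
  have hN : ∀ n : ℕ, 0 < n → |(A θ - B θ) - (A 0 - B 0)| ≤ 1 / n := by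
    intro n hn
    have hn' : (0 : ℝ) < n := by exact_mod_cast hn
    let p : ℕ → ℝ := fun i => θ * i / n
    have hp : ∀ i, i ≤ n → p i ∈ Icc (0 : ℝ) 1 := by
      intro i hi
      have hi' : (i : ℝ) ≤ n := by exact_mod_cast hi
      have := hθ.1
      refine ⟨by positivity, ?_⟩
      rw [div_le_one hn']
      nlinarith [hθ.2]
    have hsum : ∀ m, m ≤ n → |(A (p m) - B (p m)) - (A (p 0) - B (p 0))| ≤
        θ / n * (q (p m) - q (p 0)) := by
      intro m
      induction m with
      | zero => intro _; simp
      | succ k ih =>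
        intro hk
        have h1 := ih (by omega)
        have h2 := hD _ (hp k (by omega)) _ (hp (k + 1) hk)
        have h3 : p (k + 1) - p k = θ / n := by
          simp only [p]; push_cast; ring
        rw [h3] at h2
        calc _ ≤ |(A (p (k+1)) - B (p (k+1))) - (A (p k) - B (p k))| +
              |(A (p k) - B (p k)) - (A (p 0) - B (p 0))| := abs_sub_le _ _ _
          _ ≤ _ := by linarith
    have h1 := hsum n le_rfl
    have hpn : p n = θ := by simp only [p]; field_simp
    have hp0 : p 0 = 0 := by simp [p]
    rw [hpn, hp0] at h1
    refine h1.trans ?_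
    have h2 := (hq θ hθ).2
    have h3 := (hq 0 (by simp)).1
    rw [div_mul_eq_mul_div]
    gcongr
    nlinarith [hθ.1, hθ.2]
  have hzero : |(A θ - B θ) - (A 0 - B 0)| ≤ 0 := by
    refine le_of_forall_pos_le_add fun ε hε => ?_
    obtain ⟨n, hn⟩ := exists_nat_one_div_lt hε
    have := hN (n + 1) (by omega)
    push_cast at this
    linarith
  linarith [abs_nonpos_iff.1 hzero]

theorem IsIncentiveCompatible.subgradient {σ q t : ℝ → ℝ} (hic : IsIncentiveCompatible σ q t) :
    ∀ θ ∈ Icc (0 : ℝ) 1, ∀ θ' ∈ Icc (0 : ℝ) 1,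
      (θ - θ') * q θ' ≤ infoRent σ q t θ - infoRent σ q t θ' := by
  intro θ hθ θ' hθ'
  have := hic.truthful θ hθ θ' hθ'
  simp only [infoRent] at this ⊢
  linarith

theorem IsIncentiveCompatible.monotoneOn {σ q t : ℝ → ℝ} (hic : IsIncentiveCompatible σ q t) :
    MonotoneOn q (Icc 0 1) := by
  intro a ha b hb hab
  rcases hab.eq_or_lt with rfl | hlt
  · exact le_rfl
  have h1 := hic.subgradient a ha b hb
  have h2 := hic.subgradient b hb a ha
  by_contra! hc
  nlinarith

/-- The price schedule of an incentive compatible mechanism. -/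
theorem IsIncentiveCompatible.exists_isLayered {σ q t : ℝ → ℝ}
    (hic : IsIncentiveCompatible σ q t) : ∃ h, IsLayered q h ∧ ∀ θ ∈ Icc (0 : ℝ) 1,
      t θ - σ (q θ) = (∫ x in (0 : ℝ)..q θ, h x) - infoRent σ q t 0 := by
  obtain ⟨h, hl⟩ := SupraPricing.exists_isLayered hic.monotoneOn hic.quantity_mem
  refine ⟨h, hl, fun θ hθ => ?_⟩
  have h0 : (0 : ℝ) ∈ Icc (0 : ℝ) 1 := by simp
  have hB : ∀ θ ∈ Icc (0 : ℝ) 1, ∀ θ' ∈ Icc (0 : ℝ) 1, (θ - θ') * q θ' ≤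
      (∫ x in (0 : ℝ)..q θ, (θ - h x)) - ∫ x in (0 : ℝ)..q θ', (θ' - h x) := by
    intro θ hθ θ' hθ'
    have := hl.integral_sub_le hθ (hl.quantity_mem θ' hθ')
    rw [hl.integral_sub θ (q θ')] at this
    rw [hl.integral_sub θ' (q θ')]
    linarith
  have h1 := sub_eq_of_subgradient hic.quantity_mem hic.subgradient hB hθ
  -- Type 0 may receive a positive quantity, but its integral is both nonnegative (best choice) and
  -- nonpositive (`h ≥ 0`).
  have h2 : ∫ x in (0 : ℝ)..q 0, ((0 : ℝ) - h x) = 0 := by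
    refine le_antisymm ?_ (hl.integral_sub_nonneg h0)
    rw [intervalIntegral.integral_of_le (hl.quantity_mem 0 h0).1]
    exact integral_nonpos fun x => by simpa using (hl.mem x).1
  rw [h2, hl.integral_sub] at h1
  simp only [infoRent] at h1 ⊢
  linarith

/-! ### The concave survival function and the monopoly threshold. -/

/-- `G` is the survival function of a distribution `F` on `[0, 1]` with a continuous nondecreasing
density `f` that is positive on `(0, 1]`. -/
structure IsConcaveSurvival (F : Measure ℝ) (f G : ℝ → ℝ) : Prop where
  isProbabilityMeasure : IsProbabilityMeasure F
  nullSingletonClass : NullSingletonClass F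
  ae_mem : ∀ᵐ θ ∂F, θ ∈ Icc (0 : ℝ) 1
  real_Ici : ∀ s ∈ Icc (0 : ℝ) 1, F.real (Ici s) = G s
  continuousOn : ContinuousOn G (Icc 0 1)
  strictAntiOn : StrictAntiOn G (Icc 0 1)
  zero : G 0 = 1
  one : G 1 = 0
  density_continuousOn : ContinuousOn f (Icc 0 1)
  density_monotoneOn : MonotoneOn f (Icc 0 1)
  density_pos : ∀ θ ∈ Ioc (0 : ℝ) 1, 0 < f θ
  le_tangent : ∀ s ∈ Icc (0 : ℝ) 1, ∀ k ∈ Icc (0 : ℝ) 1, G k ≤ G s - (k - s) * f s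

theorem IsTypeDistribution.exists_isConcaveSurvival {F : Measure ℝ} {f : ℝ → ℝ}
    (hF : IsTypeDistribution F f) (hf : MonotoneOn f (Icc 0 1)) :
    ∃ G, IsConcaveSurvival F f G := by
  have hprob := hF.isProbabilityMeasure
  -- Only `θ = 0` is at issue: a negative value there would persist to the right by continuity.
  have hnonneg : ∀ θ ∈ Icc (0 : ℝ) 1, 0 ≤ f θ := by
    have hcl : Icc (0 : ℝ) 1 ⊆ closure (Ioc (0 : ℝ) 1) := by
      rw [closure_Ioc zero_ne_one]
    intro θ hθ
    rcases hθ.1.eq_or_lt with h0 | h0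
    · subst h0
      by_contra! hneg
      have hc := (hF.continuousOn 0 hθ).mono (Ioc_subset_Icc_self (a := (0 : ℝ)) (b := 1))
      have hev := hc.eventually (gt_mem_nhds hneg)
      have : (nhdsWithin (0 : ℝ) (Ioc 0 1)).NeBot := mem_closure_iff_nhdsWithin_neBot.1 (hcl hθ)
      obtain ⟨x, hx, hx'⟩ := (hev.and self_mem_nhdsWithin).exists
      linarith [hF.pos x hx']
    · exact (hF.pos θ ⟨h0, hθ.2⟩).le
  have hint : ∀ a ∈ Icc (0 : ℝ) 1, ∀ b ∈ Icc (0 : ℝ) 1, IntervalIntegrable f volume a b := by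
    intro a ha b hb
    exact (hF.continuousOn.mono (uIcc_subset_Icc ha hb)).intervalIntegrable
  have h1 : (1 : ℝ) ∈ Icc (0 : ℝ) 1 := by simp
  have h0 : (0 : ℝ) ∈ Icc (0 : ℝ) 1 := by simp
  have hsub : ∀ a ∈ Icc (0 : ℝ) 1, ∀ b ∈ Icc (0 : ℝ) 1,
      (∫ x in a..1, f x) - ∫ x in b..1, f x = ∫ x in a..b, f x := by
    intro a ha b hb
    rw [sub_eq_iff_eq_add, intervalIntegral.integral_add_adjacent_intervals (hint a ha b hb)
      (hint b hb 1 h1)]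
  have hreal : ∀ s ∈ Icc (0 : ℝ) 1, F.real (Ici s) = ∫ x in s..1, f x := by
    intro s hs
    have hset : Ici s ∩ Icc (0 : ℝ) 1 = Icc s 1 := by
      ext x; simp only [mem_inter_iff, mem_Ici, mem_Icc]
      exact ⟨fun hx => ⟨hx.1, hx.2.2⟩, fun hx => ⟨hx.1, hs.1.trans hx.1, hx.2⟩⟩
    have hsI : Icc s 1 ⊆ Icc (0 : ℝ) 1 := Icc_subset_Icc_left hs.1
    rw [measureReal_def, hF.eq_withDensity, withDensity_apply _ measurableSet_Ici,
      Measure.restrict_restrict measurableSet_Ici, hset, ← ofReal_integral_eq_lintegral_ofReal,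
      ENNReal.toReal_ofReal, intervalIntegral.integral_of_le hs.2, integral_Icc_eq_integral_Ioc]
    · exact setIntegral_nonneg measurableSet_Icc fun x hx => hnonneg x (hsI hx)
    · exact (hF.continuousOn.mono hsI).integrableOn_Icc
    · rw [Filter.EventuallyLE, ae_restrict_iff' measurableSet_Icc]
      exact ae_of_all _ fun x hx => hnonneg x (hsI hx)
  have hac : F ≪ volume.restrict (Icc (0 : ℝ) 1) := by
    rw [hF.eq_withDensity]; exact withDensity_absolutelyContinuous _ _
  have hmem : ∀ᵐ θ ∂F, θ ∈ Icc (0 : ℝ) 1 := hac.ae_le (ae_restrict_mem measurableSet_Icc)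
  have hatoms : NullSingletonClass F := ⟨fun x => hac (by simp)⟩
  refine ⟨fun s => ∫ x in s..1, f x, ⟨hprob, hatoms, hmem, hreal, ?_, ?_, ?_, by simp,
    hF.continuousOn, hf, hF.pos, ?_⟩⟩
  · have hcont := intervalIntegral.continuousOn_primitive_interval'
      (hint 0 h0 1 h1) (by simp : (1 : ℝ) ∈ uIcc 0 1)
    rw [uIcc_of_le zero_le_one] at hcont
    refine hcont.neg.congr fun s _ => ?_
    simp [intervalIntegral.integral_symm s 1]
  · intro a ha b hb hab
    have := hsub a ha b hb
    have hpos : 0 < ∫ x in a..b, f x :=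
      intervalIntegral.intervalIntegral_pos_of_pos_on (hint a ha b hb)
        (fun x hx => hF.pos x ⟨ha.1.trans_lt hx.1, hx.2.le.trans hb.2⟩) hab
    linarith
  · rw [← hreal 0 h0]
    have : F (Ici 0) = 1 := by
      rw [← prob_compl_eq_zero_iff measurableSet_Ici]
      exact measure_mono_null (fun x hx (hx' : x ∈ Icc (0 : ℝ) 1) => hx hx'.1) hmem
    simp [measureReal_def, this]
  · intro s hs k hk
    have h := hsub s hs k hk
    have hconst : ∫ _ in s..k, f s = (k - s) * f s := by simp
    have : (k - s) * f s ≤ ∫ x in s..k, f x := by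
      rw [← hconst]
      rcases le_total s k with hle | hle
      · refine intervalIntegral.integral_mono_on hle intervalIntegrable_const (hint s hs k hk) ?_
        exact fun x hx => hf hs ⟨hs.1.trans hx.1, hx.2.trans hk.2⟩ hx.1
      · rw [intervalIntegral.integral_symm, intervalIntegral.integral_symm k s, neg_le_neg_iff]
        refine intervalIntegral.integral_mono_on hle (hint k hk s hs) intervalIntegrable_const ?_
        exact fun x hx => hf ⟨hk.1.trans hx.1, hx.2.trans hs.2⟩ hs hx.2
    linarith

namespace IsConcaveSurvival

variable {F : Measure ℝ} {f G : ℝ → ℝ}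

theorem mem_Icc (hG : IsConcaveSurvival F f G) {s : ℝ} (hs : s ∈ Icc (0 : ℝ) 1) :
    G s ∈ Icc (0 : ℝ) 1 :=
  ⟨hG.one ▸ hG.strictAntiOn.antitoneOn hs (by simp) hs.2,
    hG.zero ▸ hG.strictAntiOn.antitoneOn (by simp) hs hs.1⟩

theorem pos (hG : IsConcaveSurvival F f G) {s : ℝ} (hs : s ∈ Ico (0 : ℝ) 1) : 0 < G s :=
  hG.one ▸ hG.strictAntiOn ⟨hs.1, hs.2.le⟩ (by simp) hs.2

/-- The first order condition for `s * G s`: `s * f s - G s` runs from `-1` at 0 to `f 1 > 0` at 1.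
-/
theorem exists_monopoly_threshold (hG : IsConcaveSurvival F f G) :
    ∃ k ∈ Ioo (0 : ℝ) 1, k * f k = G k := by
  have hc : ContinuousOn (fun s => s * f s - G s) (Icc 0 1) :=
    (continuousOn_id.mul hG.density_continuousOn).sub hG.continuousOn
  have hf1 := hG.density_pos 1 (by simp)
  have h := intermediate_value_Ioo zero_le_one hc
  obtain ⟨k, hk, hk'⟩ := h (show (0 : ℝ) ∈ _ by simp [hG.zero, hG.one, hf1])
  exact ⟨k, hk, by simpa [sub_eq_zero] using hk'⟩

/-- Some `k'` above the monopoly threshold still has `k' f(k') < 2 G(k')`. -/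
theorem exists_gt_threshold (hG : IsConcaveSurvival F f G) {k : ℝ} (hk : k ∈ Ioo (0 : ℝ) 1)
    (hkf : k * f k = G k) : ∃ k' ∈ Ioo k 1, k' * f k' < 2 * G k' := by
  have hc : ContinuousOn (fun s => s * f s - 2 * G s) (Icc 0 1) :=
    (continuousOn_id.mul hG.density_continuousOn).sub (continuousOn_const.mul hG.continuousOn)
  have hlt : k * f k - 2 * G k < 0 := by linarith [hG.pos ⟨hk.1.le, hk.2⟩]
  have hev := (hc.continuousAt (Icc_mem_nhds hk.1 hk.2)).eventually (gt_mem_nhds hlt)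
  have hev' : ∀ᶠ s in nhdsWithin k (Ioi k), s * f s - 2 * G s < 0 := hev.filter_mono inf_le_left
  obtain ⟨s, hs, hs'⟩ := (hev'.and (Ioo_mem_nhdsGT hk.2)).exists
  exact ⟨s, hs', by linarith⟩

/-- With marginal cost `s - G(s) / f(s)`, the monopoly price is `s`. -/
theorem revenue_le (hG : IsConcaveSurvival F f G) {s k : ℝ} (hs : s ∈ Ioc (0 : ℝ) 1)
    (hk : k ∈ Icc (0 : ℝ) 1) : G k * (k - (s - G s / f s)) ≤ G s * (G s / f s) := by
  have hf := hG.density_pos s hs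
  have ht := hG.le_tangent s ⟨hs.1.le, hs.2⟩ k hk
  have hGs := (hG.mem_Icc ⟨hs.1.le, hs.2⟩).1
  have hGk := (hG.mem_Icc hk).1
  -- With a nonnegative margin, replacing `G` by its tangent at `s` bounds profit by a parabola in
  -- `k` with vertex at `s`; with a negative margin profit is nonpositive.
  rcases le_total 0 (k - (s - G s / f s)) with hp | hp
  · refine (mul_le_mul_of_nonneg_right ht hp).trans ?_
    have : (G s - (k - s) * f s) * (k - (s - G s / f s)) =
        G s * (G s / f s) - (k - s) ^ 2 * f s := by field_simp; ring
    rw [this]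
    nlinarith [sq_nonneg (k - s)]
  · exact (mul_nonpos_of_nonneg_of_nonpos hGk hp).trans (by positivity)

/-- Tonelli's theorem for the region below the graph of a layered allocation. -/
theorem integrable_and_integral (hG : IsConcaveSurvival F f G) {q h : ℝ → ℝ}
    (hl : IsLayered q h) {w : ℝ → ℝ} {B : ℝ} (hw : Measurable w)
    (hB : ∀ x ∈ Ioc (0 : ℝ) 1, |w x| ≤ B) :
    Integrable (fun θ => ∫ x in (0 : ℝ)..q θ, w x) F ∧
      ∫ θ, (∫ x in (0 : ℝ)..q θ, w x) ∂F = ∫ x in (0 : ℝ)..1, G (h x) * w x := by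
  have := hG.isProbabilityMeasure
  have := hG.nullSingletonClass
  have key := hl.integrable_and_integral hG.ae_mem hw hB
  refine ⟨key.1, key.2.trans ?_⟩
  rw [intervalIntegral.integral_of_le zero_le_one]
  simp only [hG.real_Ici _ (hl.mem _)]

end IsConcaveSurvival

theorem intervalIntegrable_of_measurable_of_bound {w : ℝ → ℝ} {B : ℝ} (hw : Measurable w)
    (hB : ∀ x ∈ Ioc (0 : ℝ) 1, |w x| ≤ B) : IntervalIntegrable w volume 0 1 := by
  rw [intervalIntegrable_iff_integrableOn_Ioc_of_le zero_le_one]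
  exact Integrable.of_bound hw.aestronglyMeasurable B
    ((ae_restrict_iff' measurableSet_Ioc).2 (ae_of_all _ hB))

theorem intervalIntegral_lt_of_le_of_lt_on {v w : ℝ → ℝ} {a b : ℝ} (hab : a < b) (ha : 0 ≤ a)
    (hb : b ≤ 1) (hv : IntervalIntegrable v volume 0 1) (hw : IntervalIntegrable w volume 0 1)
    (hle : ∀ x ∈ Ioc (0 : ℝ) 1, v x ≤ w x) (hlt : ∀ x ∈ Ioo a b, v x < w x) :
    ∫ x in (0 : ℝ)..1, v x < ∫ x in (0 : ℝ)..1, w x := by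
  refine intervalIntegral.integral_lt_integral_of_ae_le_of_measure_setOfPred_lt_ne_zero zero_le_one
    hv hw ((ae_restrict_iff' measurableSet_Ioc).2 (ae_of_all _ hle)) ?_
  have hsub : Ioo a b ⊆ {x | v x < w x} ∩ Ioc 0 1 := fun x hx =>
    ⟨hlt x hx, ha.trans_lt hx.1, hx.2.le.trans hb⟩
  have hpos : 0 < volume (Ioo a b) := by simp [hab]
  exact (hpos.trans_le ((measure_mono hsub).trans
    (Measure.le_restrict_apply _ _))).ne'

namespace IsConcaveSurvival

variable {F : Measure ℝ} {f G : ℝ → ℝ}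

theorem measurable_comp (hG : IsConcaveSurvival F f G) {h : ℝ → ℝ} (hh : Monotone h)
    (hmem : ∀ x, h x ∈ Icc (0 : ℝ) 1) : Measurable fun x => G (h x) :=
  Antitone.measurable fun _ _ hxy => hG.strictAntiOn.antitoneOn (hmem _) (hmem _) (hh hxy)

theorem intervalIntegrable_mul (hG : IsConcaveSurvival F f G) {h : ℝ → ℝ} (hh : Monotone h)
    (hmem : ∀ x, h x ∈ Icc (0 : ℝ) 1) {w : ℝ → ℝ} {B : ℝ} (hw : Measurable w)
    (hB : ∀ x ∈ Ioc (0 : ℝ) 1, |w x| ≤ B) :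
    IntervalIntegrable (fun x => G (h x) * w x) volume 0 1 := by
  refine intervalIntegrable_of_measurable_of_bound (B := B)
    ((hG.measurable_comp hh hmem).mul hw) fun x hx => ?_
  have h1 := hG.mem_Icc (hmem x)
  rw [abs_mul, abs_of_nonneg h1.1]
  exact (mul_le_of_le_one_left (abs_nonneg _) h1.2).trans (hB x hx)

/-- Supplies measurability and the bound by the value at `g 0`. Positive thresholds avoid a possible
zero of `f` at 0. -/
theorem antitone_hazard (hG : IsConcaveSurvival F f G) {g : ℝ → ℝ} (hg : Monotone g)
    (hmem : ∀ x, g x ∈ Ioc (0 : ℝ) 1) : Antitone fun x => G (g x) / f (g x) := by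
  have hI : ∀ x, g x ∈ Icc (0 : ℝ) 1 := fun x => ⟨(hmem x).1.le, (hmem x).2⟩
  intro x y hxy
  have h1 := hG.strictAntiOn.antitoneOn (hI x) (hI y) (hg hxy)
  have h2 := hG.density_monotoneOn (hI x) (hI y) (hg hxy)
  exact div_le_div₀ (hG.mem_Icc (hI x)).1 h1 (hG.density_pos _ (hmem x)) h2

theorem hazard_nonneg (hG : IsConcaveSurvival F f G) {s : ℝ} (hs : s ∈ Ioc (0 : ℝ) 1) :
    0 ≤ G s / f s :=
  div_nonneg (hG.mem_Icc ⟨hs.1.le, hs.2⟩).1 (hG.density_pos _ hs).le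

theorem abs_hazard_le (hG : IsConcaveSurvival F f G) {g : ℝ → ℝ} (hg : Monotone g)
    (hmem : ∀ x, g x ∈ Ioc (0 : ℝ) 1) : ∀ x ∈ Ioc (0 : ℝ) 1,
      |G (g x) / f (g x)| ≤ G (g 0) / f (g 0) := by
  intro x hx
  rw [abs_of_nonneg (hG.hazard_nonneg (hmem x))]
  exact hG.antitone_hazard hg hmem hx.1.le

end IsConcaveSurvival

theorem IsLayered.abs_le {q h : ℝ → ℝ} (hl : IsLayered q h) : ∀ x ∈ Ioc (0 : ℝ) 1, |h x| ≤ 1 :=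
  fun x _ => by rw [abs_of_nonneg (hl.mem x).1]; exact (hl.mem x).2

/-! ### The firm's problem, solved unit by unit. -/

/-- Every layered allocation with positive thresholds `g` is optimal for the firm under the policy
whose marginal tax is the virtual value of the marginal consumer. -/
theorem IsLayered.isOptimal {F : Measure ℝ} {f G : ℝ → ℝ} (hG : IsConcaveSurvival F f G)
    {σ q t g : ℝ → ℝ} {c : ℝ} (hl : IsLayered q g) (hg : ∀ x, 0 < g x)
    (hσ : ∀ Q ∈ Icc (0 : ℝ) 1, σ Q = c - ∫ x in (0 : ℝ)..Q, (g x - G (g x) / f (g x)))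
    (ht : ∀ θ ∈ Icc (0 : ℝ) 1, t θ = ∫ x in (0 : ℝ)..q θ, G (g x) / f (g x)) :
    IsOptimal F σ q t ∧
      (∀ θ ∈ Icc (0 : ℝ) 1, infoRent σ q t θ = c + ∫ x in (0 : ℝ)..q θ, (θ - g x)) ∧
      ∫ θ, t θ ∂F = ∫ x in (0 : ℝ)..1, G (g x) * (G (g x) / f (g x)) ∧
      Integrable (fun θ => σ (q θ)) F ∧
      ∫ θ, σ (q θ) ∂F = c - ∫ x in (0 : ℝ)..1, G (g x) * (g x - G (g x) / f (g x)) := by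
  have hprob := hG.isProbabilityMeasure
  have hmem : ∀ x, g x ∈ Ioc (0 : ℝ) 1 := fun x => ⟨hg x, (hl.mem x).2⟩
  have hr := (hG.antitone_hazard hl.mono hmem)
  have hrB := hG.abs_hazard_le hl.mono hmem
  have hrm := hr.measurable
  have hφm : Measurable fun x => g x - G (g x) / f (g x) := hl.mono.measurable.sub hrm
  have hφB : ∀ x ∈ Ioc (0 : ℝ) 1, |g x - G (g x) / f (g x)| ≤ 1 + G (g 0) / f (g 0) :=
    fun x hx => (abs_sub _ _).trans (add_le_add (hl.abs_le x hx) (hrB x hx))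
  have h0 : (0 : ℝ) ∈ Icc (0 : ℝ) 1 := by simp
  have hσ0 : σ 0 = c := by simpa using hσ 0 h0
  have hIr : ∀ a b, IntervalIntegrable (fun x => G (g x) / f (g x)) volume a b :=
    fun a b => hr.intervalIntegrable
  have hIg : ∀ a b, IntervalIntegrable g volume a b := fun a b => hl.intervalIntegrable a b
  obtain ⟨hic, hrent⟩ := hl.isIncentiveCompatible (σ := σ) (t := t) (a := c)
    (fun θ hθ => by
      rw [ht θ hθ]
      exact intervalIntegral.integral_nonneg (hl.quantity_mem θ hθ).1
        fun x _ => hG.hazard_nonneg (hmem x))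
    (fun θ hθ => by
      rw [ht θ hθ, hσ _ (hl.quantity_mem θ hθ),
        intervalIntegral.integral_sub (hIg _ _) (hIr _ _)]
      ring)
  have hfub := hG.integrable_and_integral hl hrm hrB
  have htae : t =ᵐ[F] fun θ => ∫ x in (0 : ℝ)..q θ, G (g x) / f (g x) := by
    filter_upwards [hG.ae_mem] with θ hθ using ht θ hθ
  have hEt : ∫ θ, t θ ∂F = ∫ x in (0 : ℝ)..1, G (g x) * (G (g x) / f (g x)) := by
    rw [integral_congr_ae htae, hfub.2]
  have hfub' := hG.integrable_and_integral hl hφm hφB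
  have hσae : (fun θ => σ (q θ)) =ᵐ[F]
      fun θ => c - ∫ x in (0 : ℝ)..q θ, (g x - G (g x) / f (g x)) := by
    filter_upwards [hG.ae_mem] with θ hθ using hσ _ (hl.quantity_mem θ hθ)
  refine ⟨⟨⟨hic, ?_, hfub.1.congr htae.symm⟩, ?_⟩, hrent, hEt,
    ((integrable_const c).sub hfub'.1).congr hσae.symm, ?_⟩
  · intro θ hθ
    rw [hσ0, hrent θ hθ]
    linarith [hl.integral_sub_nonneg hθ]
  · intro p s hps
    obtain ⟨h, hlp, hs⟩ := hps.incentiveCompatible.exists_isLayered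
    have hIR := hps.individuallyRational 0 h0
    rw [hσ0] at hIR
    have hwm : Measurable fun x => h x - (g x - G (g x) / f (g x)) := hlp.mono.measurable.sub hφm
    have hwB : ∀ x ∈ Ioc (0 : ℝ) 1, |h x - (g x - G (g x) / f (g x))| ≤
        1 + (1 + G (g 0) / f (g 0)) :=
      fun x hx => (abs_sub _ _).trans (add_le_add (hlp.abs_le x hx) (hφB x hx))
    have hfubp := hG.integrable_and_integral hlp hwm hwB
    -- A rival mechanism earns price minus marginal tax on each unit, plus a constant that
    -- participation of type 0 makes nonpositive.
    have hsae : s =ᵐ[F] fun θ => (∫ x in (0 : ℝ)..p θ, (h x - (g x - G (g x) / f (g x)))) +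
        (c - infoRent σ p s 0) := by
      filter_upwards [hG.ae_mem] with θ hθ
      rw [intervalIntegral.integral_sub (hlp.intervalIntegrable _ _) ((hIg _ _).sub (hIr _ _))]
      linarith [hs θ hθ, hσ _ (hlp.quantity_mem θ hθ)]
    rw [integral_congr_ae hsae, integral_add hfubp.1 (integrable_const _), hfubp.2, hEt,
      integral_const, probReal_univ, one_smul]
    have hmono : ∫ x in (0 : ℝ)..1, G (h x) * (h x - (g x - G (g x) / f (g x))) ≤
        ∫ x in (0 : ℝ)..1, G (g x) * (G (g x) / f (g x)) := by
      refine intervalIntegral.integral_mono_on zero_le_one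
        (hG.intervalIntegrable_mul hlp.mono hlp.mem hwm hwB)
        (hG.intervalIntegrable_mul hl.mono hl.mem hrm hrB) fun x _ => ?_
      exact hG.revenue_le (hmem x) (hlp.mem x)
    linarith
  · rw [integral_congr_ae hσae, MeasureTheory.integral_sub (integrable_const c) hfub'.1, hfub'.2,
      integral_const, probReal_univ, one_smul]

/-- At the constant threshold `k` the virtual value is zero, so the supporting policy is no tax at
all. -/
theorem isOptimal_threshold {F : Measure ℝ} {f G : ℝ → ℝ} (hG : IsConcaveSurvival F f G) {k : ℝ}
    (hk : k ∈ Ioo (0 : ℝ) 1) (hkf : k * f k = G k) :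
    ∃ t, IsOptimal F noTax (threshold k) t := by
  have hl : IsLayered (threshold k) fun _ => k := by
    refine ⟨monotone_const, fun _ => ⟨hk.1.le, hk.2.le⟩, ?_, ?_, ?_⟩
    · intro θ hθ
      by_cases h : θ ∈ Icc k 1 <;> simp [threshold, h]
    · intro θ hθ x hx hlt
      by_contra! hc
      have : threshold k θ = 0 := by simp [threshold, hc.not_ge]
      linarith [hx.1]
    · intro θ hθ x hx hgt
      by_contra! hc
      have : threshold k θ = 1 := by simp [threshold, hc.le, hθ.2]
      linarith [hx.2]
  have hz : k - G k / f k = 0 := by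
    have := hG.density_pos k ⟨hk.1, hk.2.le⟩
    rw [← hkf]; field_simp; ring
  exact ⟨_, (hl.isOptimal hG (c := 0) (σ := noTax) (fun _ => hk.1)
    (fun Q _ => by simp [noTax, hz]) fun _ _ => rfl).1⟩

/-- Without an excise tax the firm serves every type above the monopoly threshold fully. -/
theorem eq_one_of_isOptimal_excise {F : Measure ℝ} {f G : ℝ → ℝ} (hG : IsConcaveSurvival F f G)
    {k : ℝ} (hk : k ∈ Ioo (0 : ℝ) 1) (hkf : k * f k = G k) {C τ : ℝ} {q t : ℝ → ℝ} (hτ : τ ≤ 0)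
    (hopt : IsOptimal F (excise C τ) q t) : ∀ θ ∈ Ioc k 1, q θ = 1 := by
  have hprob := hG.isProbabilityMeasure
  obtain ⟨h, hl, ht⟩ := hopt.implementable.incentiveCompatible.exists_isLayered
  have hkI : k ∈ Icc (0 : ℝ) 1 := ⟨hk.1.le, hk.2.le⟩
  have h0 : (0 : ℝ) ∈ Icc (0 : ℝ) 1 := by simp
  have hIR := hopt.implementable.individuallyRational 0 h0
  -- The competing mechanism lowers every threshold above `k` to `k`; `τ ≤ 0` keeps its transfers
  -- nonnegative.
  have hl' : IsLayered (fun θ => if θ < k then q θ else 1) (fun x => min (h x) k) := by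
    refine ⟨fun x y hxy => min_le_min_right k (hl.mono hxy),
      fun x => ⟨le_min (hl.mem x).1 hkI.1, (min_le_right _ _).trans hkI.2⟩, ?_, ?_, ?_⟩
    · intro θ hθ
      split_ifs
      · exact hl.quantity_mem θ hθ
      · simp
    · intro θ hθ x hx hlt
      split_ifs at hlt with hc
      · exact (min_le_left _ _).trans (hl.le_of_lt θ hθ x hx hlt)
      · exact (min_le_right _ _).trans (not_lt.1 hc)
    · intro θ hθ x hx hlt
      split_ifs at hlt with hc
      · exact le_min (hl.le_of_gt θ hθ x hx hlt) hc.le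
      · linarith [hx.2]
  have hwm : ∀ {q' h' : ℝ → ℝ}, IsLayered q' h' → Measurable fun x => h' x - τ :=
    fun hl => hl.mono.measurable.sub_const τ
  have hwB : ∀ {q' h' : ℝ → ℝ}, IsLayered q' h' → ∀ x ∈ Ioc (0 : ℝ) 1, |h' x - τ| ≤ 1 + |τ| :=
    fun hl x hx => (abs_sub _ _).trans (by linarith [hl.abs_le x hx])
  have hwI : ∀ {q' h' : ℝ → ℝ}, IsLayered q' h' → ∀ Q : ℝ,
      ∫ x in (0 : ℝ)..Q, (h' x - τ) = (∫ x in (0 : ℝ)..Q, h' x) - τ * Q := by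
    intro q' h' hl Q
    rw [intervalIntegral.integral_sub (hl.intervalIntegrable _ _) intervalIntegrable_const]
    simp [mul_comm]
  have hfub := hG.integrable_and_integral hl (hwm hl) (hwB hl)
  have hfub' := hG.integrable_and_integral hl' (hwm hl') (hwB hl')
  obtain ⟨hic, hrent⟩ := hl'.isIncentiveCompatible (σ := excise C τ) (a := C)
    (t := fun θ => ∫ x in (0 : ℝ)..if θ < k then q θ else 1, (min (h x) k - τ))
    (fun θ hθ => intervalIntegral.integral_nonneg (hl'.quantity_mem θ hθ).1
        fun x _ => by linarith [(hl'.mem x).1])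
    (fun θ hθ => by
      rw [hwI hl', excise]
      ring)
  have hle := hopt.revenue_le _ _ ⟨hic, fun θ hθ => by
    rw [hrent θ hθ]
    have := hl'.integral_sub_nonneg hθ
    simp only [excise]
    linarith, hfub'.1⟩
  have htae : t =ᵐ[F] fun θ => (∫ x in (0 : ℝ)..q θ, (h x - τ)) +
      (C - infoRent (excise C τ) q t 0) := by
    filter_upwards [hG.ae_mem] with θ hθ
    have := ht θ hθ
    rw [hwI hl]
    simp only [excise] at this ⊢
    linarith
  rw [integral_congr_ae htae, integral_add hfub.1 (integrable_const _), hfub.2, hfub'.2,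
    integral_const, probReal_univ, one_smul] at hle
  have hIR' : C ≤ infoRent (excise C τ) q t 0 := by simpa [excise] using hIR
  -- Tangent of `G` at `k` and `k f(k) = G(k)`: the gap is at least `((h x - k)² - τ (h x - k))
  -- f(k)`, positive for `τ ≤ 0`.
  have hstrict : ∀ x, k < h x → G (h x) * (h x - τ) < G k * (k - τ) := by
    intro x hx
    have h1 := hG.le_tangent k hkI (h x) (hl.mem x)
    have hf := hG.density_pos k ⟨hk.1, hk.2.le⟩
    have h2 : G (h x) * (h x - τ) ≤ (G k - (h x - k) * f k) * (h x - τ) :=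
      mul_le_mul_of_nonneg_right h1 (by linarith [(hl.mem x).1])
    rw [← hkf] at h2 ⊢
    have h3 : 0 < (h x - k) ^ 2 * f k := by
      have : 0 < h x - k := by linarith
      positivity
    have h4 : 0 ≤ -τ * (h x - k) * f k :=
      mul_nonneg (mul_nonneg (by linarith) (by linarith)) hf.le
    nlinarith
  intro θ hθ
  have hθI : θ ∈ Icc (0 : ℝ) 1 := ⟨hk.1.le.trans hθ.1.le, hθ.2⟩
  by_contra hne
  have hqθ := hl.quantity_mem θ hθI
  have hlt : q θ < 1 := lt_of_le_of_ne hqθ.2 hne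
  -- If `q θ < 1`, the units between `q θ` and 1 have thresholds at least `θ > k`, a set of positive
  -- measure with a strict gain.
  have := intervalIntegral_lt_of_le_of_lt_on hlt hqθ.1 le_rfl
    (hG.intervalIntegrable_mul hl.mono hl.mem (hwm hl) (hwB hl))
    (hG.intervalIntegrable_mul hl'.mono hl'.mem (hwm hl') (hwB hl'))
    (fun x _ => by
      rcases le_or_gt (h x) k with hc | hc
      · simp [min_eq_left hc]
      · simpa [min_eq_right hc.le] using (hstrict x hc).le)
    (fun x hx => by
      have hc : k < h x := hθ.1.trans_le
        (hl.le_of_gt θ hθI x ⟨hqθ.1.trans hx.1.le, hx.2.le⟩ hx.1)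
      simpa [min_eq_right hc.le] using hstrict x hc)
  linarith

/-! ### Rescaling upper quantiles and the lower bound on optimal revenue. -/

/-- `H` is the inverse of the survival function `G`. -/
structure IsInverseSurvival (G H : ℝ → ℝ) : Prop where
  mem : ∀ u ∈ Icc (0 : ℝ) 1, H u ∈ Icc (0 : ℝ) 1
  right_inv : ∀ u ∈ Icc (0 : ℝ) 1, G (H u) = u

namespace IsConcaveSurvival

variable {F : Measure ℝ} {f G H : ℝ → ℝ}

theorem exists_isInverseSurvival (hG : IsConcaveSurvival F f G) :
    ∃ H, IsInverseSurvival G H := by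
  have h := intermediate_value_Icc' zero_le_one hG.continuousOn
  rw [hG.zero, hG.one] at h
  choose! H hH using h
  exact ⟨H, fun u hu => (hH hu).1, fun u hu => (hH hu).2⟩

theorem inverse_lt_iff (hG : IsConcaveSurvival F f G) (hH : IsInverseSurvival G H) {u s : ℝ}
    (hu : u ∈ Icc (0 : ℝ) 1) (hs : s ∈ Icc (0 : ℝ) 1) : H u < s ↔ G s < u := by
  rw [← hG.strictAntiOn.lt_iff_gt hs (hH.mem u hu), hH.right_inv u hu]

theorem le_inverse_iff (hG : IsConcaveSurvival F f G) (hH : IsInverseSurvival G H) {u s : ℝ}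
    (hu : u ∈ Icc (0 : ℝ) 1) (hs : s ∈ Icc (0 : ℝ) 1) : s ≤ H u ↔ u ≤ G s := by
  rw [← hG.strictAntiOn.le_iff_ge (hH.mem u hu) hs, hH.right_inv u hu]

theorem inverse_le_iff (hG : IsConcaveSurvival F f G) (hH : IsInverseSurvival G H) {u s : ℝ}
    (hu : u ∈ Icc (0 : ℝ) 1) (hs : s ∈ Icc (0 : ℝ) 1) : H u ≤ s ↔ G s ≤ u := by
  rw [← hG.strictAntiOn.le_iff_ge hs (hH.mem u hu), hH.right_inv u hu]

theorem inverse_anti (hG : IsConcaveSurvival F f G) (hH : IsInverseSurvival G H) {u v : ℝ}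
    (hu : u ∈ Icc (0 : ℝ) 1) (hv : v ∈ Icc (0 : ℝ) 1) (huv : u ≤ v) : H v ≤ H u := by
  rw [hG.inverse_le_iff hH hv (hH.mem u hu), hH.right_inv u hu]
  exact huv

theorem mul_mem (hG : IsConcaveSurvival F f G) {l s : ℝ} (hl : l ∈ Ioo (0 : ℝ) 1)
    (hs : s ∈ Icc (0 : ℝ) 1) : l * G s ∈ Icc (0 : ℝ) 1 :=
  ⟨mul_nonneg hl.1.le (hG.mem_Icc hs).1, mul_le_one₀ hl.2.le (hG.mem_Icc hs).1 (hG.mem_Icc hs).2⟩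

end IsConcaveSurvival

/-- The type whose upper quantile is `1 / l` times that of `θ`, truncated at the type `0`. -/
def upscale (G H : ℝ → ℝ) (l θ : ℝ) : ℝ := H (min (G (max 0 (min 1 θ)) / l) 1)

namespace IsConcaveSurvival

variable {F : Measure ℝ} {f G H : ℝ → ℝ} {l : ℝ}

theorem upscale_arg_mem (hG : IsConcaveSurvival F f G) (hl : l ∈ Ioo (0 : ℝ) 1) (θ : ℝ) :
    min (G (max 0 (min 1 θ)) / l) 1 ∈ Icc (0 : ℝ) 1 :=
  ⟨le_min (div_nonneg (hG.mem_Icc ⟨le_max_left _ _, max_le zero_le_one (min_le_left _ _)⟩).1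
    hl.1.le) zero_le_one, min_le_right _ _⟩

theorem monotone_upscale (hG : IsConcaveSurvival F f G) (hH : IsInverseSurvival G H)
    (hl : l ∈ Ioo (0 : ℝ) 1) : Monotone (upscale G H l) := by
  intro a b hab
  refine hG.inverse_anti hH (hG.upscale_arg_mem hl b) (hG.upscale_arg_mem hl a) ?_
  refine min_le_min_right 1 (div_le_div_of_nonneg_right ?_ hl.1.le)
  exact hG.strictAntiOn.antitoneOn ⟨le_max_left _ _, max_le zero_le_one (min_le_left _ _)⟩
    ⟨le_max_left _ _, max_le zero_le_one (min_le_left _ _)⟩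
    (max_le_max_left 0 (min_le_min_left 1 hab))

theorem upscale_mem (hG : IsConcaveSurvival F f G) (hH : IsInverseSurvival G H)
    (hl : l ∈ Ioo (0 : ℝ) 1) (θ : ℝ) : upscale G H l θ ∈ Icc (0 : ℝ) 1 :=
  hH.mem _ (hG.upscale_arg_mem hl θ)

theorem upscale_eq (hG : IsConcaveSurvival F f G) (hH : IsInverseSurvival G H)
    (hl : l ∈ Ioo (0 : ℝ) 1) {θ : ℝ} (hθ : θ ∈ Icc (0 : ℝ) 1) (hb : H l ≤ θ) :
    G θ / l ∈ Icc (0 : ℝ) 1 ∧ upscale G H l θ = H (G θ / l) := by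
  rw [hG.inverse_le_iff hH ⟨hl.1.le, hl.2.le⟩ hθ] at hb
  have h1 : G θ / l ≤ 1 := (div_le_one hl.1).2 hb
  exact ⟨⟨div_nonneg (hG.mem_Icc hθ).1 hl.1.le, h1⟩, by
    rw [upscale, min_eq_right hθ.2, max_eq_right hθ.1, min_eq_left h1]⟩

theorem le_upscale_iff (hG : IsConcaveSurvival F f G) (hH : IsInverseSurvival G H)
    (hl : l ∈ Ioo (0 : ℝ) 1) {θ s : ℝ} (hθ : θ ∈ Icc (0 : ℝ) 1) (hs : s ∈ Icc (0 : ℝ) 1)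
    (hb : H l ≤ θ) : s ≤ upscale G H l θ ↔ H (l * G s) ≤ θ := by
  obtain ⟨h1, h2⟩ := hG.upscale_eq hH hl hθ hb
  rw [h2, hG.le_inverse_iff hH h1 hs, hG.inverse_le_iff hH (hG.mul_mem hl hs) hθ, div_le_iff₀' hl.1]

theorem upscale_le_iff (hG : IsConcaveSurvival F f G) (hH : IsInverseSurvival G H)
    (hl : l ∈ Ioo (0 : ℝ) 1) {θ s : ℝ} (hθ : θ ∈ Icc (0 : ℝ) 1) (hs : s ∈ Icc (0 : ℝ) 1)
    (hb : H l ≤ θ) : upscale G H l θ ≤ s ↔ θ ≤ H (l * G s) := by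
  obtain ⟨h1, h2⟩ := hG.upscale_eq hH hl hθ hb
  rw [h2, hG.inverse_le_iff hH h1 hs, hG.le_inverse_iff hH (hG.mul_mem hl hs) hθ, le_div_iff₀' hl.1]

/-- The top fraction `l` of types is stretched onto the whole distribution. Hence
`integrable_upscale`: charging `t` at the stretched types earns exactly `l` times the original
revenue. -/
theorem map_upscale (hG : IsConcaveSurvival F f G) (hH : IsInverseSurvival G H)
    (hl : l ∈ Ioo (0 : ℝ) 1) :
    (F.restrict (Ici (H l))).map (upscale G H l) = ENNReal.ofReal l • F := by
  have hprob := hG.isProbabilityMeasure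
  have hmeas := (hG.monotone_upscale hH hl).measurable
  have hlI : l ∈ Icc (0 : ℝ) 1 := ⟨hl.1.le, hl.2.le⟩
  have hFI : ∀ s ∈ Icc (0 : ℝ) 1, F (Ici s) = ENNReal.ofReal (G s) := by
    intro s hs
    rw [← hG.real_Ici s hs, ofReal_measureReal]
  have key : ∀ a ∈ Icc (0 : ℝ) 1, ((F.restrict (Ici (H l))).map (upscale G H l)) (Ici a) =
      ENNReal.ofReal l * F (Ici a) := by
    intro a ha
    rw [Measure.map_apply hmeas measurableSet_Ici,
      Measure.restrict_apply (hmeas measurableSet_Ici), hFI a ha, ← ENNReal.ofReal_mul hl.1.le]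
    have hβ := hG.mul_mem hl ha
    rw [← hH.right_inv _ hβ, ← hFI _ (hH.mem _ hβ)]
    refine measure_congr ?_
    filter_upwards [hG.ae_mem] with θ hθ
    refine propext ⟨fun hx => (hG.le_upscale_iff hH hl hθ ha hx.2).1 hx.1, fun hx => ?_⟩
    have hb : H l ≤ θ := (hG.inverse_anti hH hβ hlI
      (mul_le_of_le_one_right hl.1.le (hG.mem_Icc ha).2)).trans hx
    exact ⟨(hG.le_upscale_iff hH hl hθ ha hb).2 hx, hb⟩
  refine Measure.ext_of_Ici _ _ fun a => ?_
  rw [Measure.smul_apply, smul_eq_mul]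
  rcases lt_or_ge a 0 with h0 | h0
  · have h1 := key 0 (by simp)
    have e1 : ((F.restrict (Ici (H l))).map (upscale G H l)) (Ici a) =
        ((F.restrict (Ici (H l))).map (upscale G H l)) (Ici 0) := by
      rw [Measure.map_apply hmeas measurableSet_Ici, Measure.map_apply hmeas measurableSet_Ici]
      congr 1
      ext θ
      have := (hG.upscale_mem hH hl θ).1
      simp only [mem_preimage, mem_Ici, this, iff_true]
      linarith
    have e2 : F (Ici a) = F (Ici 0) := by
      refine measure_congr ?_
      filter_upwards [hG.ae_mem] with θ hθ
      exact propext ⟨fun _ => hθ.1, fun _ => h0.le.trans hθ.1⟩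
    rw [e1, h1, e2]
  rcases le_or_gt a 1 with h1 | h1
  · exact key a ⟨h0, h1⟩
  · have e1 : upscale G H l ⁻¹' Ici a = ∅ := by
      ext θ
      have := (hG.upscale_mem hH hl θ).2
      simp only [mem_preimage, mem_Ici, mem_empty_iff_false, iff_false]
      linarith
    have e2 : F (Ici a) = 0 := by
      refine measure_eq_zero_iff_ae_notMem.2 ?_
      filter_upwards [hG.ae_mem] with θ hθ using not_le.2 (hθ.2.trans_lt h1)
    rw [Measure.map_apply hmeas measurableSet_Ici, e1, e2]
    simp

theorem integrable_upscale (hG : IsConcaveSurvival F f G) (hH : IsInverseSurvival G H)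
    (hl : l ∈ Ioo (0 : ℝ) 1) {t : ℝ → ℝ} (ht : Integrable t F) :
    Integrable ((Ici (H l)).indicator fun θ => t (upscale G H l θ)) F ∧
      ∫ θ, (Ici (H l)).indicator (fun θ => t (upscale G H l θ)) θ ∂F = l * ∫ θ, t θ ∂F := by
  have hmeas := (hG.monotone_upscale hH hl).measurable
  have hmap := hG.map_upscale hH hl
  have hint : Integrable t ((F.restrict (Ici (H l))).map (upscale G H l)) := by
    rw [hmap]; exact ht.smul_measure ENNReal.ofReal_ne_top
  refine ⟨(integrable_indicator_iff measurableSet_Ici).2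
    ((integrable_map_measure hint.1 hmeas.aemeasurable).1 hint), ?_⟩
  rw [integral_indicator measurableSet_Ici, ← integral_map hmeas.aemeasurable hint.1, hmap,
    integral_smul_measure, ENNReal.toReal_ofReal hl.1.le, smul_eq_mul]

theorem le_inverse_mul (hG : IsConcaveSurvival F f G) (hH : IsInverseSurvival G H)
    (hl : l ∈ Ioo (0 : ℝ) 1) {s : ℝ} (hs : s ∈ Icc (0 : ℝ) 1) : s ≤ H (l * G s) := by
  rw [hG.le_inverse_iff hH (hG.mul_mem hl hs) hs]
  exact mul_le_of_le_one_left (hG.mem_Icc hs).1 hl.2.le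

theorem monotone_inverse_mul (hG : IsConcaveSurvival F f G) (hH : IsInverseSurvival G H)
    (hl : l ∈ Ioo (0 : ℝ) 1) {h : ℝ → ℝ} (hh : Monotone h) (hmem : ∀ x, h x ∈ Icc (0 : ℝ) 1) :
    Monotone fun x => H (l * G (h x)) := fun _ _ hxy =>
  hG.inverse_anti hH (hG.mul_mem hl (hmem _)) (hG.mul_mem hl (hmem _))
    (mul_le_mul_of_nonneg_left (hG.strictAntiOn.antitoneOn (hmem _) (hmem _) (hh hxy)) hl.1.le)

/-- The inverse hazard rate with the density truncated below `k` is measurable and bounded. -/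
theorem measurable_div_max (hG : IsConcaveSurvival F f G) {h g : ℝ → ℝ} (hh : Monotone h)
    (hhm : ∀ x, h x ∈ Icc (0 : ℝ) 1) (hg : Monotone g) (hgm : ∀ x, g x ∈ Icc (0 : ℝ) 1)
    {k : ℝ} (hk : k ∈ Ioc (0 : ℝ) 1) :
    Measurable (fun x => G (h x) / f (max (g x) k)) ∧
      ∀ x, |G (h x) / f (max (g x) k)| ≤ 1 / f k := by
  have hkI : k ∈ Icc (0 : ℝ) 1 := ⟨hk.1.le, hk.2⟩
  have hmx : ∀ x, max (g x) k ∈ Icc (0 : ℝ) 1 := fun x =>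
    ⟨hkI.1.trans (le_max_right _ _), max_le (hgm x).2 hk.2⟩
  have hfk := hG.density_pos k hk
  have hfm : ∀ x, f k ≤ f (max (g x) k) := fun x =>
    hG.density_monotoneOn hkI (hmx x) (le_max_right _ _)
  have hmono : Monotone fun x => f (max (g x) k) := fun x y hxy =>
    hG.density_monotoneOn (hmx x) (hmx y) (max_le_max_right k (hg hxy))
  refine ⟨(hG.measurable_comp hh hhm).div hmono.measurable, fun x => ?_⟩
  have h1 := hG.mem_Icc (hhm x)
  rw [abs_of_nonneg (div_nonneg h1.1 (hfk.le.trans (hfm x)))]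
  exact div_le_div₀ zero_le_one h1.2 hfk (hfm x)

end IsConcaveSurvival

/-- The firm's gain from selling each allocation to a slightly smaller set of types bounds its
revenue from below. -/
theorem IsOptimal.mul_integral_le {F : Measure ℝ} {f G H : ℝ → ℝ} (hG : IsConcaveSurvival F f G)
    (hH : IsInverseSurvival G H) {l : ℝ} (hl : l ∈ Ioo (0 : ℝ) 1) {σ q t h : ℝ → ℝ}
    (hopt : IsOptimal F σ q t) (hlay : IsLayered q h)
    (ht : ∀ θ ∈ Icc (0 : ℝ) 1,
      t θ - σ (q θ) = (∫ x in (0 : ℝ)..q θ, h x) - infoRent σ q t 0)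
    {k : ℝ} (hk : k ∈ Ioc (0 : ℝ) 1) :
    l * ∫ x in (0 : ℝ)..1, G (h x) * (G (h x) / f (max (H (l * G (h x))) k)) ≤ ∫ θ, t θ ∂F := by
  have hprob := hG.isProbabilityMeasure
  have hic := hopt.implementable.incentiveCompatible
  have hlI : l ∈ Icc (0 : ℝ) 1 := ⟨hl.1.le, hl.2.le⟩
  have h0 : (0 : ℝ) ∈ Icc (0 : ℝ) 1 := by simp
  have hIR := hopt.implementable.individuallyRational 0 h0
  set α := upscale G H l with hα
  set β : ℝ → ℝ := fun x => H (l * G (h x)) with hβ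
  have hαI : ∀ θ, α θ ∈ Icc (0 : ℝ) 1 := hG.upscale_mem hH hl
  have hβI : ∀ x, β x ∈ Icc (0 : ℝ) 1 := fun x => hH.mem _ (hG.mul_mem hl (hlay.mem x))
  have hβmono : Monotone β := hG.monotone_inverse_mul hH hl hlay.mono hlay.mem
  have hhβ : ∀ x, h x ≤ β x := fun x => hG.le_inverse_mul hH hl (hlay.mem x)
  have hbβ : ∀ x, H l ≤ β x := fun x => hG.inverse_anti hH (hG.mul_mem hl (hlay.mem x)) hlI
    (mul_le_of_le_one_right hl.1.le (hG.mem_Icc (hlay.mem x)).2)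
  -- The deviation uses only quantities in the range of `q`, and 0, so the values of `σ` elsewhere
  -- are irrelevant. Its thresholds satisfy `G (β x) = l * G (h x)`.
  set q' : ℝ → ℝ := fun θ => if θ < H l then 0 else q (α θ) with hq'
  have hlay' : IsLayered q' β := by
    refine ⟨hβmono, hβI, fun θ _ => ?_, fun θ hθ x hx hlt => ?_, fun θ hθ x hx hlt => ?_⟩
    · simp only [hq']
      split_ifs
      · simp
      · exact hlay.quantity_mem _ (hαI θ)
    · simp only [hq'] at hlt
      split_ifs at hlt with hc
      · linarith [hx.1]
      · exact (hG.le_upscale_iff hH hl hθ (hlay.mem x) (not_lt.1 hc)).1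
          (hlay.le_of_lt _ (hαI θ) x hx hlt)
    · simp only [hq'] at hlt
      split_ifs at hlt with hc
      · exact hc.le.trans (hbβ x)
      · exact (hG.upscale_le_iff hH hl hθ (hlay.mem x) (not_lt.1 hc)).1
          (hlay.le_of_gt _ (hαI θ) x hx hlt)
  have hwm : Measurable fun x => β x - h x := hβmono.measurable.sub hlay.mono.measurable
  have hwB : ∀ x ∈ Ioc (0 : ℝ) 1, |β x - h x| ≤ 1 := fun x _ => by
    rw [abs_of_nonneg (sub_nonneg.2 (hhβ x))]
    linarith [(hβI x).2, (hlay.mem x).1]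
  have hsub : ∀ Q, ∫ x in (0 : ℝ)..Q, (β x - h x) =
      (∫ x in (0 : ℝ)..Q, β x) - ∫ x in (0 : ℝ)..Q, h x := fun Q =>
    intervalIntegral.integral_sub hβmono.intervalIntegrable (hlay.intervalIntegrable _ _)
  -- Old transfer, plus the rise in thresholds, plus the slack in participation: three nonnegative
  -- terms, leaving type 0 exactly `σ 0`.
  set t' : ℝ → ℝ := fun θ => (Ici (H l)).indicator (fun θ => t (α θ)) θ +
    (∫ x in (0 : ℝ)..q' θ, (β x - h x)) +
    (Ici (H l)).indicator (fun _ => infoRent σ q t 0 - σ 0) θ with ht'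
  obtain ⟨hic', hrent⟩ := hlay'.isIncentiveCompatible (σ := σ) (t := t') (a := σ 0)
    (fun θ hθ => by
      refine add_nonneg (add_nonneg ?_ ?_) ?_
      · exact indicator_nonneg (fun θ _ => hic.transfer_nonneg _ (hαI θ)) θ
      · exact intervalIntegral.integral_nonneg (hlay'.quantity_mem θ hθ).1
          fun x _ => sub_nonneg.2 (hhβ x)
      · exact indicator_nonneg (fun _ _ => sub_nonneg.2 hIR) θ)
    (fun θ hθ => by
      simp only [ht', hsub]
      by_cases hc : θ < H l
      · have hn : θ ∉ Ici (H l) := not_le.2 hc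
        simp [hq', hc]
      · have hn : θ ∈ Ici (H l) := not_lt.1 hc
        simp only [hq', hc, if_false, indicator_of_mem hn]
        linarith [ht (α θ) (hαI θ)])
  have hup := hG.integrable_upscale hH hl hopt.implementable.integrable
  have hupc := hG.integrable_upscale hH hl (integrable_const (infoRent σ q t 0 - σ 0))
  have hfub := hG.integrable_and_integral hlay' hwm hwB
  have hle := hopt.revenue_le q' t' ⟨hic', fun θ hθ => by
    rw [hrent θ hθ]
    linarith [hlay'.integral_sub_nonneg hθ], (hup.1.add hfub.1).add hupc.1⟩
  have hEt := (integral_add (hup.1.add hfub.1) hupc.1).trans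
    (congrArg (· + _) (integral_add hup.1 hfub.1))
  simp only [hup.2, hupc.2, hfub.2, integral_const, probReal_univ, one_smul] at hEt
  replace hle := hEt.symm.trans_le hle
  have hdiv := hG.measurable_div_max hlay.mono hlay.mem hβmono hβI hk
  have hmono : ∫ x in (0 : ℝ)..1, (1 - l) * l * (G (h x) * (G (h x) / f (max (β x) k))) ≤
      ∫ x in (0 : ℝ)..1, G (β x) * (β x - h x) := by
    refine intervalIntegral.integral_mono_on zero_le_one
      ((hG.intervalIntegrable_mul hlay.mono hlay.mem hdiv.1 fun x _ => hdiv.2 x).const_mul _)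
      (hG.intervalIntegrable_mul hβmono hβI hwm hwB) fun x _ => ?_
    have hGβ : G (β x) = l * G (h x) := hH.right_inv _ (hG.mul_mem hl (hlay.mem x))
    have hmx : max (β x) k ∈ Ioc (0 : ℝ) 1 :=
      ⟨hk.1.trans_le (le_max_right _ _), max_le (hβI x).2 hk.2⟩
    have hf := hG.density_pos _ hmx
    have h1 := hG.le_tangent (β x) (hβI x) (h x) (hlay.mem x)
    have h2 := hG.density_monotoneOn (hβI x) ⟨hmx.1.le, hmx.2⟩ (le_max_left (β x) k)
    -- The tangent at `β x` gives `(1 - l) * G (h x) ≤ (β x - h x) * f (β x)`. The factor `1 - l`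
    -- later cancels against `(1 - l)` times the revenue.
    have h3 : (1 - l) * (G (h x) / f (max (β x) k)) ≤ β x - h x := by
      rw [← mul_div_assoc, div_le_iff₀ hf]
      have := mul_le_mul_of_nonneg_left h2 (sub_nonneg.2 (hhβ x))
      rw [hGβ] at h1
      linarith
    rw [hGβ]
    have h4 := mul_le_mul_of_nonneg_left h3
      (mul_nonneg hl.1.le (hG.mem_Icc (hlay.mem x)).1)
    linarith
  rw [intervalIntegral.integral_const_mul] at hmono
  have h5 : 0 ≤ l * (infoRent σ q t 0 - σ 0) := mul_nonneg hl.1.le (sub_nonneg.2 hIR)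
  have h6 : 0 < 1 - l := by linarith [hl.2]
  refine le_of_mul_le_mul_left ?_ h6
  linarith

/-- Only the upper estimate needs the limit, since `s ≤ H (l * G s)` always holds. -/
theorem IsConcaveSurvival.tendsto_inverse_mul {F : Measure ℝ} {f G H : ℝ → ℝ}
    (hG : IsConcaveSurvival F f G) (hH : IsInverseSurvival G H) {l : ℕ → ℝ}
    (hl : ∀ n, l n ∈ Ioo (0 : ℝ) 1) (hlim : Filter.Tendsto l Filter.atTop (nhds 1)) {s : ℝ}
    (hs : s ∈ Icc (0 : ℝ) 1) :
    Filter.Tendsto (fun n => H (l n * G s)) Filter.atTop (nhds s) := by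
  refine tendsto_order.2 ⟨fun a ha => Filter.Eventually.of_forall fun n =>
    ha.trans_le (hG.le_inverse_mul hH (hl n) hs), fun b hb => ?_⟩
  rcases lt_or_ge 1 b with h1 | h1
  · exact Filter.Eventually.of_forall fun n => (hH.mem _ (hG.mul_mem (hl n) hs)).2.trans_lt h1
  · have hbI : b ∈ Icc (0 : ℝ) 1 := ⟨hs.1.trans hb.le, h1⟩
    have hlt := hG.strictAntiOn hs hbI hb
    have hlim' : Filter.Tendsto (fun n => l n * G s) Filter.atTop (nhds (G s)) := by
      simpa using hlim.mul_const (G s)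
    filter_upwards [hlim'.eventually (lt_mem_nhds hlt)] with n hn
    exact (hG.inverse_lt_iff hH (hG.mul_mem (hl n) hs) hbI).2 hn

/-- The revenue of an optimal mechanism is at least the one given by the envelope formula, with
the inverse hazard rate truncated below a positive type. -/
theorem IsOptimal.integral_le {F : Measure ℝ} {f G : ℝ → ℝ} (hG : IsConcaveSurvival F f G)
    {σ q t h : ℝ → ℝ} (hopt : IsOptimal F σ q t) (hlay : IsLayered q h)
    (ht : ∀ θ ∈ Icc (0 : ℝ) 1,
      t θ - σ (q θ) = (∫ x in (0 : ℝ)..q θ, h x) - infoRent σ q t 0)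
    {k : ℝ} (hk : k ∈ Ioc (0 : ℝ) 1) :
    ∫ x in (0 : ℝ)..1, G (h x) * (G (h x) / f (max (h x) k)) ≤ ∫ θ, t θ ∂F := by
  obtain ⟨H, hH⟩ := hG.exists_isInverseSurvival
  let l : ℕ → ℝ := fun n => 1 - 1 / ((n : ℝ) + 2)
  have hl : ∀ n, l n ∈ Ioo (0 : ℝ) 1 := by
    intro n
    have h2 : (1 : ℝ) < (n : ℝ) + 2 := by have := n.cast_nonneg (α := ℝ); linarith
    have h3 : 1 / ((n : ℝ) + 2) < 1 := (div_lt_one (by linarith)).2 h2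
    have h4 : 0 < 1 / ((n : ℝ) + 2) := by positivity
    exact ⟨by simp only [l]; linarith, by simp only [l]; linarith⟩
  have hlim : Filter.Tendsto l Filter.atTop (nhds 1) := by
    have h1 : Filter.Tendsto (fun n : ℕ => 1 / ((n : ℝ) + 2)) Filter.atTop (nhds 0) :=
      tendsto_const_nhds.div_atTop
        (Filter.tendsto_atTop_add_const_right _ _ tendsto_natCast_atTop_atTop)
    simpa [l] using h1.const_sub 1
  have hint : Filter.Tendsto (fun n => ∫ x in (0 : ℝ)..1,
      G (h x) * (G (h x) / f (max (H (l n * G (h x))) k))) Filter.atTop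
      (nhds (∫ x in (0 : ℝ)..1, G (h x) * (G (h x) / f (max (h x) k)))) := by
    have hdiv := fun n => hG.measurable_div_max hlay.mono hlay.mem
      (hG.monotone_inverse_mul hH (hl n) hlay.mono hlay.mem)
      (fun x => hH.mem _ (hG.mul_mem (hl n) (hlay.mem x))) hk
    -- Truncating the density's argument at `k > 0` provides the uniform bound `1 / f k`, even if `f
    -- 0 = 0`.
    refine intervalIntegral.tendsto_integral_filter_of_dominated_convergence
      (fun _ => 1 / f k) (Filter.Eventually.of_forall fun n => ?_)
      (Filter.Eventually.of_forall fun n => ae_of_all _ fun x _ => ?_)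
      intervalIntegrable_const (ae_of_all _ fun x _ => ?_)
    · exact ((hG.measurable_comp hlay.mono hlay.mem).mul (hdiv n).1).aestronglyMeasurable
    · have h1 := hG.mem_Icc (hlay.mem x)
      rw [Real.norm_eq_abs, abs_mul, abs_of_nonneg h1.1]
      exact (mul_le_of_le_one_left (abs_nonneg _) h1.2).trans ((hdiv n).2 x)
    · have hmx : ∀ {s : ℝ}, s ∈ Icc (0 : ℝ) 1 → max s k ∈ Icc (0 : ℝ) 1 := fun hs =>
        ⟨hs.1.trans (le_max_left _ _), max_le hs.2 hk.2⟩
      have hm : Filter.Tendsto (fun n => max (H (l n * G (h x))) k) Filter.atTop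
          (nhdsWithin (max (h x) k) (Icc 0 1)) :=
        tendsto_nhdsWithin_iff.2 ⟨(hG.tendsto_inverse_mul hH hl hlim (hlay.mem x)).max
          tendsto_const_nhds, Filter.Eventually.of_forall fun n =>
            hmx (hH.mem _ (hG.mul_mem (hl n) (hlay.mem x)))⟩
      have hf := (hG.density_continuousOn _ (hmx (hlay.mem x))).tendsto.comp hm
      have hpos := hG.density_pos (max (h x) k)
        ⟨hk.1.trans_le (le_max_right _ _), (hmx (hlay.mem x)).2⟩
      exact (tendsto_const_nhds.div hf hpos.ne').const_mul _
  have hlim' := hlim.mul hint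
  rw [one_mul] at hlim'
  exact le_of_tendsto' hlim' fun n => hopt.mul_integral_le hG hH (hl n) hlay ht hk

/-! ### Second order stochastic dominance of rents. -/

/-- Tonelli turns the dominance criterion into expected shortfalls below `z`. Clamping the type to
`[0, 1]` makes the rent globally monotone, hence measurable. -/
theorem lintegral_rentCDF {F : Measure ℝ} [IsProbabilityMeasure F]
    (hF : ∀ᵐ θ ∂F, θ ∈ Icc (0 : ℝ) 1) {I : ℝ → ℝ} (hI : MonotoneOn I (Icc 0 1)) (z : ℝ) :
    ∫⁻ x in Iic z, rentCDF F I x = ∫⁻ θ, ENNReal.ofReal (z - I θ) ∂F := by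
  set J : ℝ → ℝ := fun θ => I (max 0 (min 1 θ)) with hJ
  have hJm : Measurable J := by
    refine Monotone.measurable fun a b hab => hI ?_ ?_ ?_
    · exact ⟨le_max_left _ _, max_le zero_le_one (min_le_left _ _)⟩
    · exact ⟨le_max_left _ _, max_le zero_le_one (min_le_left _ _)⟩
    · exact max_le_max_left 0 (min_le_min_left 1 hab)
  have hIJ : ∀ᵐ θ ∂F, I θ = J θ := by
    filter_upwards [hF] with θ hθ
    simp only [hJ, min_eq_right hθ.2, max_eq_right hθ.1]
  have hS : MeasurableSet {p : ℝ × ℝ | J p.2 ≤ p.1} :=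
    measurableSet_le (hJm.comp measurable_snd) measurable_fst
  have h1 : ∀ x, rentCDF F I x =
      ∫⁻ θ, {p : ℝ × ℝ | J p.2 ≤ p.1}.indicator (fun _ => (1 : ℝ≥0∞)) (x, θ) ∂F := by
    intro x
    have e1 : rentCDF F I x = F {θ | J θ ≤ x} := by
      refine measure_congr ?_
      filter_upwards [hIJ] with θ hθ
      exact propext (show I θ ≤ x ↔ J θ ≤ x by rw [hθ])
    rw [e1, ← lintegral_indicator_one (measurableSet_le hJm measurable_const)]
    rfl
  simp only [h1]
  rw [lintegral_lintegral_swap (f := fun x θ =>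
    {p : ℝ × ℝ | J p.2 ≤ p.1}.indicator (fun _ => (1 : ℝ≥0∞)) (x, θ))
    (measurable_const.indicator hS).aemeasurable]
  refine lintegral_congr_ae ?_
  filter_upwards [hIJ] with θ hθ
  have e2 : (fun x => {p : ℝ × ℝ | J p.2 ≤ p.1}.indicator (fun _ => (1 : ℝ≥0∞)) (x, θ)) =
      (Ici (J θ)).indicator 1 := by
    ext x; simp [indicator]
  rw [e2, lintegral_indicator_one measurableSet_Ici, Measure.restrict_apply measurableSet_Ici,
    Ici_inter_Iic, Real.volume_Icc, hθ]

/-- A change of the information rents that favours lower types and does not lower the mean is a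
second order stochastic improvement. -/
theorem isMoreFair_of_antitoneOn_sub {F : Measure ℝ} [IsProbabilityMeasure F]
    (hF : ∀ᵐ θ ∂F, θ ∈ Icc (0 : ℝ) 1) {I I' : ℝ → ℝ} (hI : MonotoneOn I (Icc 0 1))
    (hI' : MonotoneOn I' (Icc 0 1)) (hD : AntitoneOn (fun θ => I' θ - I θ) (Icc 0 1))
    (hint : Integrable I F) (hint' : Integrable I' F) (hE : ∫ θ, I θ ∂F ≤ ∫ θ, I' θ ∂F) :
    IsMoreFair F I' I := by
  intro z
  have hp : ∀ {J : ℝ → ℝ}, Integrable J F → Integrable (fun θ => max (z - J θ) 0) F :=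
    fun hJ => ((integrable_const z).sub hJ).pos_part
  have hconv : ∀ {J : ℝ → ℝ}, Integrable J F → ∫⁻ θ, ENNReal.ofReal (z - J θ) ∂F =
      ENNReal.ofReal (∫ θ, max (z - J θ) 0 ∂F) := by
    intro J hJ
    rw [ofReal_integral_eq_lintegral_ofReal (hp hJ) (ae_of_all _ fun θ => le_max_right _ _)]
    refine lintegral_congr fun θ => ?_
    rw [ENNReal.ofReal_max]; simp
  rw [lintegral_rentCDF hF hI', lintegral_rentCDF hF hI, hconv hint, hconv hint']
  refine ENNReal.ofReal_le_ofReal ?_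
  by_cases hc : ∀ θ ∈ Icc (0 : ℝ) 1, I' θ ≤ z → I θ ≤ I' θ
  · refine integral_mono_ae (hp hint') (hp hint) ?_
    filter_upwards [hF] with θ hθ
    rcases le_or_gt (I' θ) z with h | h
    · exact max_le_max_right 0 (by linarith [hc θ hθ h])
    · rw [max_eq_right (by linarith : z - I' θ ≤ 0)]
      exact le_max_right _ _
  · push Not at hc
    obtain ⟨θ₀, hθ₀, hz, hlt⟩ := hc
    -- Types with `I' θ > z` lie above `θ₀`, where the change is already negative, so adding it only
    -- lowers the left side; its mean is nonnegative and can be dropped afterwards.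
    have hle : ∫ θ, (max (z - I' θ) 0 + (I' θ - I θ)) ∂F ≤ ∫ θ, max (z - I θ) 0 ∂F := by
      refine integral_mono_ae ((hp hint').add (hint'.sub hint)) (hp hint) ?_
      filter_upwards [hF] with θ hθ
      rcases le_or_gt (I' θ) z with h | h
      · rw [max_eq_left (by linarith : 0 ≤ z - I' θ)]
        exact le_max_of_le_left (by linarith)
      · rw [max_eq_right (by linarith : z - I' θ ≤ 0)]
        have hθθ : θ₀ ≤ θ := by
          by_contra! hgt
          linarith [hI' hθ hθ₀ hgt.le]
        have : I' θ - I θ ≤ I' θ₀ - I θ₀ := hD hθ₀ hθ hθθ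
        exact le_max_of_le_right (by linarith)
    replace hle := (integral_add (hp hint') (hint'.sub hint)).symm.trans_le hle
    rw [integral_sub' hint' hint] at hle
    linarith

theorem IsLayered.integrableOn_max {q h : ℝ → ℝ} (hl : IsLayered q h) (θ : ℝ) :
    IntegrableOn (fun x => max (θ - h x) 0) (Ioc 0 1) := by
  have hanti : Antitone fun x => max (θ - h x) 0 := fun x y hxy =>
    max_le_max_right 0 (sub_le_sub_left (hl.mono hxy) θ)
  exact (intervalIntegrable_iff_integrableOn_Ioc_of_le zero_le_one).1 hanti.intervalIntegrable

theorem IsLayered.monotone_rent {q h : ℝ → ℝ} (hl : IsLayered q h) :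
    Monotone fun θ => ∫ x in Ioc (0 : ℝ) 1, max (θ - h x) 0 := fun a b hab =>
  integral_mono (hl.integrableOn_max a) (hl.integrableOn_max b) fun _ =>
    max_le_max_right 0 (sub_le_sub_right hab _)

/-- For each unit the difference of positive parts has slope `-1` between `h x` and `g x` and is
constant elsewhere. -/
theorem IsLayered.antitone_rent_sub {q h q' g : ℝ → ℝ} (hl : IsLayered q h) (hl' : IsLayered q' g)
    (hle : ∀ x, h x ≤ g x) : Antitone fun θ =>
      (∫ x in Ioc (0 : ℝ) 1, max (θ - g x) 0) - ∫ x in Ioc (0 : ℝ) 1, max (θ - h x) 0 := by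
  intro a b hab
  have hsub : ∀ θ, (∫ x in Ioc (0 : ℝ) 1, max (θ - g x) 0) - ∫ x in Ioc (0 : ℝ) 1, max (θ - h x) 0 =
      ∫ x in Ioc (0 : ℝ) 1, (max (θ - g x) 0 - max (θ - h x) 0) := fun θ =>
    (MeasureTheory.integral_sub (hl'.integrableOn_max θ) (hl.integrableOn_max θ)).symm
  simp only [hsub]
  refine integral_mono ((hl'.integrableOn_max b).sub (hl.integrableOn_max b))
    ((hl'.integrableOn_max a).sub (hl.integrableOn_max a)) fun x => ?_
  have := hle x
  simp only [max_def]
  split_ifs <;> linarith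

/-! ### The improvement by exclusion slightly above the monopoly threshold. -/

theorem IsConcaveSurvival.integrable_quantity {F : Measure ℝ} {f G q h : ℝ → ℝ}
    (hG : IsConcaveSurvival F f G) (hl : IsLayered q h) :
    Integrable q F ∧ ∫ θ, q θ ∂F = ∫ x in (0 : ℝ)..1, G (h x) ∧
      Integrable (fun θ => θ * q θ) F := by
  have hfub := hG.integrable_and_integral hl (w := fun _ => 1) (B := 1) measurable_const (by simp)
  simp only [intervalIntegral.integral_const, sub_zero, smul_eq_mul, mul_one] at hfub
  refine ⟨hfub.1, hfub.2, hfub.1.bdd_mul (c := 1) measurable_id.aestronglyMeasurable ?_⟩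
  filter_upwards [hG.ae_mem] with θ hθ
  rw [Real.norm_eq_abs, abs_of_nonneg hθ.1]
  exact hθ.2

/-- Expected rents are the gains from trade net of the firm's revenue and the cost of the policy. -/
theorem integral_infoRent {F : Measure ℝ} {σ q t : ℝ → ℝ} (hq : Integrable (fun θ => θ * q θ) F)
    (ht : Integrable t F) (hσ : Integrable (fun θ => σ (q θ)) F) :
    Integrable (infoRent σ q t) F ∧ ∫ θ, infoRent σ q t θ ∂F =
      (∫ θ, θ * q θ ∂F) - (∫ θ, t θ ∂F) + ∫ θ, σ (q θ) ∂F :=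
  ⟨(hq.sub ht).add hσ, (integral_add (hq.sub ht) hσ).trans
    (congrArg (· + _) (integral_sub hq ht))⟩

/-- Excluding the types up to slightly above the monopoly threshold improves every feasible rent
that does not exclude the types below it. -/
theorem not_isUnimprovable {F : Measure ℝ} {f G : ℝ → ℝ} (hG : IsConcaveSurvival F f G) {k : ℝ}
    (hk : k ∈ Ioo (0 : ℝ) 1) (hkf : k * f k = G k) {I σ q t : ℝ → ℝ} (hopt : IsOptimal F σ q t)
    (hbud : IsBudgetBalanced F σ q) (hind : IsInducedBy I σ q t) {m : ℝ} (hm : 0 < m)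
    (hq : ∀ θ ∈ Ioc k 1, m ≤ q θ) : ¬ IsUnimprovable F I := by
  have hprob := hG.isProbabilityMeasure
  obtain ⟨k', hk', hkf'⟩ := hG.exists_gt_threshold hk hkf
  have hk'0 : 0 < k' := hk.1.trans hk'.1
  have hk'I : k' ∈ Icc (0 : ℝ) 1 := ⟨hk'0.le, hk'.2.le⟩
  have hfk' := hG.density_pos k' ⟨hk'0, hk'.2.le⟩
  obtain ⟨h, hl, ht⟩ := hopt.implementable.incentiveCompatible.exists_isLayered
  have hl' : IsLayered (fun θ => if θ < k' then 0 else q θ) (fun x => max (h x) k') := by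
    refine ⟨fun x y hxy => max_le_max_right k' (hl.mono hxy),
      fun x => ⟨hk'0.le.trans (le_max_right _ _), max_le (hl.mem x).2 hk'I.2⟩, ?_, ?_, ?_⟩
    · intro θ hθ
      split_ifs
      · simp
      · exact hl.quantity_mem θ hθ
    · intro θ hθ x hx hlt
      split_ifs at hlt with hc
      · linarith [hx.1]
      · exact max_le (hl.le_of_lt θ hθ x hx hlt) (not_lt.1 hc)
    · intro θ hθ x hx hlt
      split_ifs at hlt with hc
      · exact hc.le.trans (le_max_right _ _)
      · exact (hl.le_of_gt θ hθ x hx hlt).trans (le_max_left _ _)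
  set q' : ℝ → ℝ := fun θ => if θ < k' then 0 else q θ with hq'
  set g : ℝ → ℝ := fun x => max (h x) k' with hg
  -- The lump sum equals expected tax proceeds, so the new policy balances exactly.
  set c : ℝ := ∫ x in (0 : ℝ)..1, G (g x) * (g x - G (g x) / f (g x)) with hc
  set σ' : ℝ → ℝ := fun Q => c - ∫ x in (0 : ℝ)..Q, (g x - G (g x) / f (g x)) with hσ'
  set t' : ℝ → ℝ := fun θ => ∫ x in (0 : ℝ)..q' θ, G (g x) / f (g x) with ht'
  have hg0 : ∀ x, 0 < g x := fun x => hk'0.trans_le (le_max_right _ _)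
  obtain ⟨hopt', hrent', hEt', hσint', hEσ'⟩ := hl'.isOptimal hG (σ := σ') (t := t') (c := c)
    hg0 (fun _ _ => rfl) (fun _ _ => rfl)
  rw [← hc, sub_self] at hEσ'
  have hrent : ∀ θ ∈ Icc (0 : ℝ) 1, infoRent σ q t θ =
      infoRent σ q t 0 + ∫ x in (0 : ℝ)..q θ, (θ - h x) := by
    intro θ hθ
    rw [hl.integral_sub, infoRent]
    linarith [ht θ hθ]
  have hIe : ∀ θ ∈ Icc (0 : ℝ) 1, I θ =
      infoRent σ q t 0 + ∫ x in Ioc (0 : ℝ) 1, max (θ - h x) 0 := fun θ hθ => by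
    rw [hind θ hθ, hrent θ hθ, hl.integral_sub_eq hθ]
  have hIe' : ∀ θ ∈ Icc (0 : ℝ) 1, infoRent σ' q' t' θ =
      c + ∫ x in Ioc (0 : ℝ) 1, max (θ - g x) 0 := fun θ hθ => by
    rw [hrent' θ hθ, hl'.integral_sub_eq hθ]
  have hIae : infoRent σ q t =ᵐ[F] I := by
    filter_upwards [hG.ae_mem] with θ hθ using (hind θ hθ).symm
  obtain ⟨hqi, hqE, hθq⟩ := hG.integrable_quantity hl
  obtain ⟨hqi', hqE', hθq'⟩ := hG.integrable_quantity hl'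
  obtain ⟨hIint, hIE⟩ := integral_infoRent hθq hopt.implementable.integrable hbud.1
  obtain ⟨hIint', hIE'⟩ := integral_infoRent hθq' hopt'.implementable.integrable hσint'
  rw [integral_congr_ae hIae] at hIE
  -- Only types below `k'` lose quantity, so each lost unit is worth at most `k'`.
  have hdiff : (∫ θ, θ * q θ ∂F) - ∫ θ, θ * q' θ ∂F ≤
      k' * ((∫ θ, q θ ∂F) - ∫ θ, q' θ ∂F) := by
    rw [← integral_sub hθq hθq', ← integral_sub hqi hqi', ← integral_const_mul]
    refine integral_mono_ae (hθq.sub hθq') ((hqi.sub hqi').const_mul k') ?_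
    filter_upwards [hG.ae_mem] with θ hθ
    simp only [hq']
    split_ifs with hc
    · have := mul_le_mul_of_nonneg_right hc.le (hl.quantity_mem θ hθ).1
      linarith
    · simp
  have hbound := hopt.integral_le hG hl ht (k := k') ⟨hk'0, hk'.2.le⟩
  have hgmem : ∀ x, g x ∈ Ioc (0 : ℝ) 1 := fun x => ⟨hg0 x, (hl'.mem x).2⟩
  have hcanon := hG.intervalIntegrable_mul hl'.mono hl'.mem
    (hG.antitone_hazard hl'.mono hgmem).measurable (hG.abs_hazard_le hl'.mono hgmem)
  have hGint : ∀ {p u : ℝ → ℝ}, IsLayered p u →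
      IntervalIntegrable (fun x => G (u x)) volume 0 1 := fun hp =>
    intervalIntegrable_of_measurable_of_bound (B := 1) (hG.measurable_comp hp.mono hp.mem)
      fun x _ => by
        have := hG.mem_Icc (hp.mem x)
        rw [abs_of_nonneg this.1]; exact this.2
  have hdiv := hG.measurable_div_max hl.mono hl.mem hl.mono hl.mem ⟨hk'0, hk'.2.le⟩
  -- A difference of squares: it suffices that `k' f(k') < G(h x) + G(k')`, which follows from `k'
  -- f(k') < 2 G(k')` and `G(h x) > G(k')`.
  have hpt : ∀ x, h x < k' → k' * (G (h x) - G (g x)) + G (g x) * (G (g x) / f (g x)) <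
      G (h x) * (G (h x) / f (max (h x) k')) := by
    intro x hx
    have hgx : g x = k' := max_eq_right hx.le
    have hlt := hG.strictAntiOn (hl.mem x) hk'I hx
    rw [hgx, max_eq_right hx.le]
    have : 0 < (G (h x) - G k') * (G (h x) + G k' - k' * f k') / f k' :=
      div_pos (mul_pos (by linarith) (by linarith)) hfk'
    have e : (G (h x) - G k') * (G (h x) + G k' - k' * f k') / f k' =
        G (h x) * (G (h x) / f k') - (k' * (G (h x) - G k') + G k' * (G k' / f k')) := by
      field_simp; ring
    linarith
  have hstrict : ∫ x in (0 : ℝ)..1, (k' * (G (h x) - G (g x)) + G (g x) * (G (g x) / f (g x))) <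
      ∫ x in (0 : ℝ)..1, G (h x) * (G (h x) / f (max (h x) k')) := by
    have hm1 : m ≤ 1 := (hq 1 ⟨hk.2, le_rfl⟩).trans (hl.quantity_mem 1 (by simp)).2
    refine intervalIntegral_lt_of_le_of_lt_on hm le_rfl hm1
      ((((hGint hl).sub (hGint hl')).const_mul k').add hcanon)
      (hG.intervalIntegrable_mul hl.mono hl.mem hdiv.1 fun x _ => hdiv.2 x)
      (fun x _ => ?_) (fun x hx => hpt x ?_)
    · rcases lt_or_ge (h x) k' with hc | hc
      · exact (hpt x hc).le
      · have hgx : g x = h x := max_eq_left hc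
        rw [hgx, max_eq_left hc]
        simp
    -- The type midway between `k` and `k'` buys at least `m`, so every unit `x < m` has its
    -- threshold strictly below `k'`.
    · have hs : (k + k') / 2 ∈ Ioc k 1 := ⟨by linarith [hk'.1], by linarith [hk'.1, hk'.2]⟩
      have := hl.le_of_lt _ ⟨hk.1.le.trans hs.1.le, hs.2⟩ x ⟨hx.1.le, hx.2.le.trans hm1⟩
        (hx.2.trans_le (hq _ hs))
      linarith [hk'.1]
  rw [intervalIntegral.integral_add (((hGint hl).sub (hGint hl')).const_mul k') hcanon,
    intervalIntegral.integral_const_mul, intervalIntegral.integral_sub (hGint hl) (hGint hl'),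
    ← hqE, ← hqE', ← hEt'] at hstrict
  have hmean : ∫ θ, I θ ∂F < ∫ θ, infoRent σ' q' t' θ ∂F := by
    rw [hIE, hIE', hEσ']
    linarith [hbud.2]
  rintro ⟨_, hun⟩
  refine hun ⟨infoRent σ' q' t', ⟨σ', q', t', hopt', ⟨hσint', hEσ'.le⟩, fun _ _ => rfl⟩, ?_,
    hmean.le, Or.inr (not_le.2 hmean)⟩
  refine isMoreFair_of_antitoneOn_sub hG.ae_mem ?_ ?_ ?_ (hIint.congr hIae) hIint' hmean.le
  · intro a ha b hb hab
    rw [hIe a ha, hIe b hb]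
    linarith [hl.monotone_rent hab]
  · intro a ha b hb hab
    rw [hIe' a ha, hIe' b hb]
    linarith [hl'.monotone_rent hab]
  · intro a ha b hb hab
    have := hl.antitone_rent_sub hl' (fun x => le_max_left (h x) k') hab
    simp only [hIe a ha, hIe b hb, hIe' a ha, hIe' b hb] at this ⊢
    linarith

/-- An unimprovable rent does not grow at a positive rate immediately above the monopoly
threshold. -/
theorem IsUnimprovable.false_of_le {F : Measure ℝ} {f G : ℝ → ℝ} (hG : IsConcaveSurvival F f G)
    {k : ℝ} (hk : k ∈ Ioo (0 : ℝ) 1) (hkf : k * f k = G k) {I σ q t : ℝ → ℝ}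
    (hI : IsUnimprovable F I) (hic : IsIncentiveCompatible σ q t) (hind : IsInducedBy I σ q t)
    {m : ℝ} (hm : 0 < m) (hq : ∀ s ∈ Ioc k 1, ∃ θ ∈ Icc (0 : ℝ) 1, θ < s ∧ m ≤ q θ) : False := by
  obtain ⟨σ₀, q₀, t₀, hopt, hbud, hind₀⟩ := hI.1
  refine not_isUnimprovable hG hk hkf hopt hbud hind₀ hm (fun s hs => ?_) hI
  obtain ⟨θ, hθ, hlt, hmq⟩ := hq s hs
  have hsI : s ∈ Icc (0 : ℝ) 1 := ⟨hk.1.le.trans hs.1.le, hs.2⟩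
  -- The mechanism witnessing feasibility may differ from `(q, t)`, but both induce `I`: the slope
  -- of `I` from `θ` to `s` is at least `q θ` and at most `q₀ s`.
  have h1 := hic.subgradient s hsI θ hθ
  have h2 := hopt.implementable.incentiveCompatible.subgradient θ hθ s hsI
  rw [← hind s hsI, ← hind θ hθ] at h1
  rw [← hind₀ s hsI, ← hind₀ θ hθ] at h2
  refine hmq.trans (le_of_mul_le_mul_left ?_ (sub_pos.2 hlt))
  linarith

end SupraPricing

end

/-! ### The main theorem. -/

theorem mainTheorem4 (F : Measure ℝ) (f : ℝ → ℝ)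
    (hF : SupraPricing.IsTypeDistribution F f) (hreg : SupraPricing.IsStronglyRegular f) :
    -- the untaxed monopolist has an optimal threshold mechanism
    (∃ k ∈ Icc (0 : ℝ) 1, ∃ t : ℝ → ℝ,
      SupraPricing.IsOptimal F SupraPricing.noTax (SupraPricing.threshold k) t) ∧
    (∀ qbar tbar : ℝ → ℝ, SupraPricing.IsOptimal F SupraPricing.noTax qbar tbar →
      -- types excluded by the monopolist are excluded on the whole frontier
      (∀ I : ℝ → ℝ, SupraPricing.IsUnimprovable F I →
        ∀ σ q t : ℝ → ℝ, SupraPricing.IsIncentiveCompatible σ q t →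
          SupraPricing.IsInducedBy I σ q t →
          ∀ θ ∈ Icc (0 : ℝ) 1, qbar θ = 0 → q θ = 0) ∧
      -- the monopoly rent is feasible but improvable
      SupraPricing.IsFeasible F (SupraPricing.infoRent SupraPricing.noTax qbar tbar) ∧
      ¬ SupraPricing.IsUnimprovable F (SupraPricing.infoRent SupraPricing.noTax qbar tbar)) ∧
    -- an excise policy on the frontier is a tax, neither zero nor a subsidy
    (∀ (C τ : ℝ) (q t : ℝ → ℝ), SupraPricing.IsOptimal F (SupraPricing.excise C τ) q t →
      SupraPricing.IsUnimprovable F (SupraPricing.infoRent (SupraPricing.excise C τ) q t) →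
      0 < τ) := by
  obtain ⟨G, hG⟩ := hF.exists_isConcaveSurvival hreg.monotoneOn
  obtain ⟨k, hk, hkf⟩ := hG.exists_monopoly_threshold
  have hexcise : ∀ (C τ : ℝ) (q t : ℝ → ℝ), SupraPricing.IsOptimal F (SupraPricing.excise C τ) q t →
      SupraPricing.IsUnimprovable F (SupraPricing.infoRent (SupraPricing.excise C τ) q t) →
      0 < τ := by
    intro C τ q t hopt hun
    by_contra! hτ
    have hq := SupraPricing.eq_one_of_isOptimal_excise hG hk hkf hτ hopt
    refine hun.false_of_le hG hk hkf hopt.implementable.incentiveCompatible (fun _ _ => rfl)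
      one_pos fun s hs => ⟨(k + s) / 2, ?_, by linarith [hs.1], (hq _ ?_).ge⟩
    · constructor <;> linarith [hk.1, hs.1, hs.2]
    · constructor <;> linarith [hs.1, hs.2]
  have hnoTax : SupraPricing.noTax = SupraPricing.excise 0 0 := by
    funext Q; simp [SupraPricing.noTax, SupraPricing.excise]
  refine ⟨⟨k, ⟨hk.1.le, hk.2.le⟩, SupraPricing.isOptimal_threshold hG hk hkf⟩,
    fun qbar tbar hopt => ⟨fun I hun σ q t hic hind θ hθ hz => ?_, ?_, fun hun => ?_⟩, hexcise⟩
  -- No tax is the excise policy with rate zero, so a type excluded by any monopoly mechanism is at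
  -- most `k`. A positive `q θ` then serves as `m`, with the witness `θ` for every `s > k`.
  · have hθk : θ ≤ k := by
      by_contra! hlt
      rw [hnoTax] at hopt
      have := SupraPricing.eq_one_of_isOptimal_excise hG hk hkf le_rfl hopt θ ⟨hlt, hθ.2⟩
      linarith
    by_contra hne
    have hpos : 0 < q θ := lt_of_le_of_ne (hic.quantity_mem θ hθ).1 (Ne.symm hne)
    exact hun.false_of_le hG hk hkf hic hind hpos fun s hs =>
      ⟨θ, hθ, hθk.trans_lt hs.1, le_rfl⟩
  · exact ⟨_, _, _, hopt, by simp [SupraPricing.IsBudgetBalanced, SupraPricing.noTax],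
      fun _ _ => rfl⟩
  · rw [hnoTax] at hopt hun
    exact lt_irrefl _ (hexcise 0 0 qbar tbar hopt hun)
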